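/- **Setting.** Let $n,k\in\mathbb N$, let $\Omega\subset\mathbb R^d$ be the closure of a bounded open convex set, and $Q=[0,1]\times\Omega$. Matrices carry the Frobenius product $A\cdot B=\mathrm{tr}(A^{T}B)$; $A^\dagger$ is the Moore–Penrose inverse; $\mathbb M^n=\mathbb R^{n\times n}$; $\mathbb S^n$, $\mathbb S^n_+$, $\mathbb S^n_{++}$ are the symmetric, positive semidefinite and positive definite matrices. Fix $\Lambda=(\Lambda_1,\Lambda_2)$ with $\Lambda_1\in\mathbb S^k_+$, $\Lambda_2\in\mathbb S^n_{++}$, and a first-order constant-coefficient linear differential operator in $x$, $\mathsf D^*\Phi=\mathsf D_0^*(\Phi)+\sum_{j=1}^d\mathsf D_{1,j}^*(\partial_{x_j}\Phi)$, with linear maps $\mathsf D_0^*,\mathsf D_{1,j}^*:\mathbb S^n\to\mathbb R^{n\times k}$ and $\mathsf D^*(I)=\mathsf D_0^*(I)=0$. Let $\mathsf G_0,\mathsf G_1$ be $\mathbb S^n_+$-valued (finite Radon) measures on $\Omega$. *Continuity equation.* $\mathcal{CE}$ is the set of triplets $\mu=(\mathsf G,\mathsf q,\mathsf R)$ of finite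 Radon measures on $Q$ with values in $\mathbb S^n$, $\mathbb R^{n\times k}$, $\mathbb M^n$ such that $$\int_Q \partial_t\Phi\cdot d\mathsf G+\mathsf D^*\Phi\cdot d\mathsf q+\Phi\cdot d\mathsf R=\int_\Omega\Phi(1,\cdot)\cdot d\mathsf G_1-\int_\Omega\Phi(0,\cdot)\cdot d\mathsf G_0\qquad\forall\,\Phi\in C^1(Q,\mathbb S^n).$$ *Action and distance.* Let $\mathcal O_\Lambda=\{(A,B,C)\in\mathbb S^n\times\mathbb R^{n\times k}\times\mathbb M^n:\ A+\tfrac12B\Lambda_1^2B^T+\tfrac12C\Lambda_2^2C^T\preceq0\}$ and let $J_\Lambda(X,Y,Z)=\sup_{(A,B,C)\in\mathcal O_\Lambda}(X\cdot A+Y\cdot B+Z\cdot C)$ be its support function. For any reference measure $\lambda$ dominating $\mu$, put $\mathcal J_{\Lambda,Q}(\mu)=\int_Q J_\Lambda\big(\tfrac{d\mu}{d\lambda}\big)\,d\lambda\in[0,\infty]$, and $$\mathrm{WB}_\Lambda^2(\mathsf G_0,\mathsf G_1)=\inf_{\mu\in\mathcal{CE}}\mathcal J_{\Lambda,Q}(\mu).$$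 $\mathcal{CE}_\infty$ is the set of $\mu\in\mathcal{CE}$ with $\mathcal J_{\Lambda,Q}(\mu)<\infty$, and $\mathcal{AC}([0,1])$ is the set of $\mathsf G$ for which some $(\mathsf q,\mathsf R)$ satisfies $(\mathsf G,\mathsf q,\mathsf R)\in\mathcal{CE}_\infty$; each such $\mathsf G$ is $\mathbb S^n_+$-valued. *Spaces.* For $\mathsf G\in\mathcal{AC}([0,1])$ with density $G$ with respect to a dominating $\lambda$, $L^2_{\mathsf G,\Lambda}(Q)$ is the space of Borel fields $(u,W):Q\to\mathbb R^{n\times k}\times\mathbb M^n$ of finite seminorm, modulo fields of seminorm zero, for the semi-inner product $$\langle(u,W),(u',W')\rangle_{L^2_{\mathsf G,\Lambda}}=\int_Q \big[(u\Lambda_1^\dagger)\cdot G\,(u'\Lambda_1^\dagger)+(W\Lambda_2^{-1})\cdot G\,(W'\Lambda_2^{-1})\big]\,d\lambda .$$ $H_{\mathsf G,\Lambda}(\mathsf D^*)$ is the closure in $L^2_{\mathsf G,\Lambda}(Q)$ of $\{(\mathsf D^*\Phi\,\Lambda_1^2,\Phi\Lambda_2^2):\Phi\in C^1(Q,\mathbb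 S^n)\}$. Put $$l_{\mathsf G}(\Phi)=\int_\Omega\Phi(1,\cdot)\cdot d\mathsf G_1-\int_\Omega\Phi(0,\cdot)\cdot d\mathsf G_0-\int_Q\partial_t\Phi\cdot d\mathsf G,$$ $$\mathcal J^\Lambda_{\mathsf G_0,\mathsf G_1}(\mathsf G)=\inf\big\{\tfrac12\|(G^\dagger q,G^\dagger R)\|^2_{L^2_{\mathsf G,\Lambda}(Q)}:\ (\mathsf G,\mathsf q,\mathsf R)\in\mathcal{CE}_\infty\big\},$$ where $G,q,R$ are densities with respect to a common dominating measure. **Theorem.** One has $$\mathrm{WB}_\Lambda^2(\mathsf G_0,\mathsf G_1)=\inf_{\mathsf G\in\mathcal{AC}([0,1])}\mathcal J^\Lambda_{\mathsf G_0,\mathsf G_1}(\mathsf G).$$ Moreover, for every $\mathsf G\in\mathcal{AC}([0,1])$: 1. There is a unique bounded linear functional on $H_{\mathsf G,\Lambda}(\mathsf D^*)$, again denoted $l_{\mathsf G}$, whose value at $(\mathsf D^*\Phi\,\Lambda_1^2,\Phi\Lambda_2^2)$ is $l_{\mathsf G}(\Phi)$ for all $\Phi\in C^1(Q,\mathbb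 S^n)$, and $$\mathcal J^\Lambda_{\mathsf G_0,\mathsf G_1}(\mathsf G)=\tfrac12\|l_{\mathsf G}\|^2_{H^*_{\mathsf G,\Lambda}(\mathsf D^*)}.$$ 2. $l_{\mathsf G}$ has a Riesz representative $(u^*_\Lambda,W^*_\Lambda)\in H_{\mathsf G,\Lambda}(\mathsf D^*)$; it satisfies $\mathcal J^\Lambda_{\mathsf G_0,\mathsf G_1}(\mathsf G)=\tfrac12\|(u^*_\Lambda,W^*_\Lambda)\|^2_{L^2_{\mathsf G,\Lambda}(Q)}$, and it is the unique solution of the minimum norm problem $$\min\big\{\tfrac12\|(u,W)\|^2_{L^2_{\mathsf G,\Lambda}(Q)}:\ (u,W)\in L^2_{\mathsf G,\Lambda}(Q),\ \langle(\mathsf D^*\Phi\,\Lambda_1^2,\Phi\Lambda_2^2),(u,W)\rangle_{L^2_{\mathsf G,\Lambda}(Q)}=l_{\mathsf G}(\Phi)\ \ \forall\,\Phi\in C^1(Q,\mathbb S^n)\big\}.$$ 3. $$\mathcal J^\Lambda_{\mathsf G_0,\mathsf G_1}(\mathsf G)=\sup_{\Phi\in C^1(Q,\mathbb S^n)}\Big\{l_{\mathsf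 G}(\Phi)-\tfrac12\big\|(\mathsf D^*\Phi\,\Lambda_1^2,\Phi\Lambda_2^2)\big\|^2_{L^2_{\mathsf G,\Lambda}(Q)}\Big\}.$$ -/

import Mathlib

open MeasureTheory Set Matrix
open scoped ENNReal RealInnerProductSpace

noncomputable section

attribute [local instance] Matrix.frobeniusNormedAddCommGroup Matrix.frobeniusNormedSpace

/-! ### Matrices -/

/-- The space `𝕊ⁿ` of real symmetric `n × n` matrices. -/
def symMat (n : ℕ) : Submodule ℝ (Matrix (Fin n) (Fin n) ℝ) where
  carrier := {A | A.IsSymm}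
  add_mem' ha hb := ha.add hb
  zero_mem' := Matrix.isSymm_zero
  smul_mem' c _ ha := ha.smul c

/-- The identity matrix as an element of `𝕊ⁿ`. -/
def symOne (n : ℕ) : symMat n := ⟨1, Matrix.isSymm_one⟩

/-- The Frobenius inner product `A · B = tr (Aᵀ B)`. -/
def frob {a b : ℕ} (A B : Matrix (Fin a) (Fin b) ℝ) : ℝ := (Aᵀ * B).trace

/-- The Moore–Penrose inverse of a real symmetric matrix `A = P diag(λᵢ) Pᵀ`, namely
`P diag(λᵢ†) Pᵀ` with `λ† = λ⁻¹` for `λ ≠ 0` and `0† = 0` (it is only used for symmetric `A`). -/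
def pinv {n : ℕ} (A : Matrix (Fin n) (Fin n) ℝ) : Matrix (Fin n) (Fin n) ℝ :=
  open Classical in
  if hA : A.IsHermitian then
    (hA.eigenvectorUnitary : Matrix (Fin n) (Fin n) ℝ) *
      Matrix.diagonal (fun i => (hA.eigenvalues i)⁻¹) *
      (hA.eigenvectorUnitary : Matrix (Fin n) (Fin n) ℝ)ᵀ
  else 0

/-- `pinv A` satisfies the four Penrose conditions. -/
theorem pinv_penrose {n : ℕ} {A : Matrix (Fin n) (Fin n) ℝ} (hA : A.IsSymm) :
    (pinv A * A)ᵀ = pinv A * A ∧ (A * pinv A)ᵀ = A * pinv A ∧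
      pinv A * A * pinv A = pinv A ∧ A * pinv A * A = A := by
  have hA' : A.IsHermitian := by
    rw [Matrix.IsHermitian, Matrix.conjTranspose_eq_transpose_of_trivial]; exact hA
  set P : Matrix (Fin n) (Fin n) ℝ := (hA'.eigenvectorUnitary : Matrix (Fin n) (Fin n) ℝ)
    with hP
  set D : Matrix (Fin n) (Fin n) ℝ := Matrix.diagonal hA'.eigenvalues with hD
  set D' : Matrix (Fin n) (Fin n) ℝ := Matrix.diagonal (fun i => (hA'.eigenvalues i)⁻¹) with hD'
  have hPP : Pᵀ * P = 1 := by
    have := Unitary.coe_star_mul_self hA'.eigenvectorUnitary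
    rwa [Matrix.star_eq_conjTranspose, Matrix.conjTranspose_eq_transpose_of_trivial] at this
  have hAeq : A = P * D * Pᵀ := by
    have h := hA'.spectral_theorem
    rw [Unitary.conjStarAlgAut_apply, Matrix.star_eq_conjTranspose,
      Matrix.conjTranspose_eq_transpose_of_trivial] at h
    exact h
  have hpinv : pinv A = P * D' * Pᵀ := by rw [pinv, dif_pos hA']
  have hmul : ∀ X Y : Matrix (Fin n) (Fin n) ℝ,
      P * X * Pᵀ * (P * Y * Pᵀ) = P * (X * Y) * Pᵀ := fun X Y => by
    calc P * X * Pᵀ * (P * Y * Pᵀ) = P * X * (Pᵀ * P) * (Y * Pᵀ) := by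
          simp only [Matrix.mul_assoc]
      _ = P * (X * Y) * Pᵀ := by rw [hPP]; simp only [Matrix.mul_assoc, Matrix.one_mul]
  have h1 : D' * D * D' = D' := by
    rw [hD, hD', Matrix.diagonal_mul_diagonal, Matrix.diagonal_mul_diagonal]
    congr 1; funext i
    by_cases h : hA'.eigenvalues i = 0 <;> simp [h]
  have h2 : D * D' * D = D := by
    rw [hD, hD', Matrix.diagonal_mul_diagonal, Matrix.diagonal_mul_diagonal]
    congr 1; funext i
    by_cases h : hA'.eigenvalues i = 0 <;> simp [h]
  have h3 : (D' * D)ᵀ = D' * D := by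
    rw [hD, hD', Matrix.diagonal_mul_diagonal, Matrix.diagonal_transpose]
  have h4 : (D * D')ᵀ = D * D' := by
    rw [hD, hD', Matrix.diagonal_mul_diagonal, Matrix.diagonal_transpose]
  have htr : ∀ X : Matrix (Fin n) (Fin n) ℝ, Xᵀ = X → (P * X * Pᵀ)ᵀ = P * X * Pᵀ := fun X hX => by
    rw [Matrix.transpose_mul, Matrix.transpose_mul, hX, Matrix.transpose_transpose,
      Matrix.mul_assoc]
  have hA2 : pinv A * A = P * (D' * D) * Pᵀ := by
    rw [hpinv]; conv_lhs => rw [hAeq]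
    exact hmul _ _
  have hA3 : A * pinv A = P * (D * D') * Pᵀ := by
    rw [hpinv]; conv_lhs => rw [hAeq]
    exact hmul _ _
  refine ⟨?_, ?_, ?_, ?_⟩
  · rw [hA2]; exact htr _ h3
  · rw [hA3]; exact htr _ h4
  · rw [hA2, hpinv, hmul, h1]
  · rw [hA3]; conv_lhs => rw [hAeq]
    rw [hmul, h2]; exact hAeq.symm

/-- A couple of weight matrices `Λ = (Λ₁, Λ₂)`, `Λ₁ ∈ 𝕊ᵏ₊`, `Λ₂ ∈ 𝕊ⁿ₊₊`. -/
structure Weights (n k : ℕ) where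
  Λ₁ : Matrix (Fin k) (Fin k) ℝ
  Λ₂ : Matrix (Fin n) (Fin n) ℝ
  posSemidef : Λ₁.PosSemidef
  posDef : Λ₂.PosDef

/-- The closed convex set `𝒪_Λ` of all `(A, B, C)` in `𝕊ⁿ × ℝⁿˣᵏ × ℝⁿˣⁿ` with
`A + ½ B Λ₁² Bᵀ + ½ C Λ₂² Cᵀ ≼ 0`. -/
def setO {n k : ℕ} (Λ : Weights n k) :
    Set (symMat n × Matrix (Fin n) (Fin k) ℝ × Matrix (Fin n) (Fin n) ℝ) :=
  {p | (-((p.1 : Matrix (Fin n) (Fin n) ℝ) + (1 / 2 : ℝ) • (p.2.1 * Λ.Λ₁ ^ 2 * p.2.1ᵀ)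
      + (1 / 2 : ℝ) • (p.2.2 * Λ.Λ₂ ^ 2 * p.2.2ᵀ))).PosSemidef}

/-- The support function `J_Λ` of `𝒪_Λ`, i.e. the conjugate of its indicator function. -/
def suppO {n k : ℕ} (Λ : Weights n k) (X : Matrix (Fin n) (Fin n) ℝ)
    (Y : Matrix (Fin n) (Fin k) ℝ) (Z : Matrix (Fin n) (Fin n) ℝ) : EReal :=
  ⨆ p ∈ setO Λ, ((frob X (p.1 : Matrix (Fin n) (Fin n) ℝ) + frob Y p.2.1 + frob Z p.2.2 : ℝ) :
    EReal)

/-! ### Matrix-valued measures -/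

section Measures

variable {X : Type*} [MeasurableSpace X]

/-- The `(i, j)` entry of a matrix-valued measure, a signed measure. -/
def entry {a b : ℕ} (μ : VectorMeasure X (Matrix (Fin a) (Fin b) ℝ)) (i : Fin a) (j : Fin b) :
    SignedMeasure X :=
  μ.mapRange (Matrix.entryAddMonoidHom ℝ i j) (continuous_id.matrix_elem i j)

/-- An `𝕊ⁿ`-valued measure regarded as a matrix-valued measure. -/
def toMat {n : ℕ} (G : VectorMeasure X (symMat n)) :
    VectorMeasure X (Matrix (Fin n) (Fin n) ℝ) :=
  G.mapRange (symMat n).subtype.toAddMonoidHom continuous_subtype_val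

/-- `G` takes values in the cone `𝕊ⁿ₊`. -/
def IsPSD {n : ℕ} (G : VectorMeasure X (symMat n)) : Prop :=
  ∀ s, MeasurableSet s → (G s : Matrix (Fin n) (Fin n) ℝ).PosSemidef

/-- A finite positive reference measure dominating `μ` (and equivalent to `|μ|`): the sum of the
total variations of the entries. -/
def refMeasure {a b : ℕ} (μ : VectorMeasure X (Matrix (Fin a) (Fin b) ℝ)) : Measure X :=
  ∑ i, ∑ j, (entry μ i j).totalVariation

/-- The density `dμ/dν` of a matrix-valued measure, entry by entry. -/
def dens {a b : ℕ} (μ : VectorMeasure X (Matrix (Fin a) (Fin b) ℝ)) (ν : Measure X) (x : X) :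
    Matrix (Fin a) (Fin b) ℝ :=
  Matrix.of fun i j => (entry μ i j).rnDeriv ν x

/-- The duality pairing `⟨μ, f⟩ = ∫ f · dμ` of a matrix-valued measure and a matrix field. -/
def pairing {a b : ℕ} (μ : VectorMeasure X (Matrix (Fin a) (Fin b) ℝ))
    (f : X → Matrix (Fin a) (Fin b) ℝ) : ℝ :=
  ∑ i, ∑ j, ∫ᵛ x, f x i j ∂<•(entry μ i j)

/-- A reference measure dominating the triplet `(G, q, R)`. -/
def refTriple {n k : ℕ} (G : VectorMeasure X (symMat n))
    (q : VectorMeasure X (Matrix (Fin n) (Fin k) ℝ))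
    (R : VectorMeasure X (Matrix (Fin n) (Fin n) ℝ)) : Measure X :=
  refMeasure (toMat G) + refMeasure q + refMeasure R

/-- The `Λ`-weighted action functional `∫ J_Λ(dμ/dν) dν` of `μ = (G, q, R)`, in `[0, ∞]`
(`J_Λ ≥ 0` because `0 ∈ 𝒪_Λ`; by homogeneity of `J_Λ` any dominating `ν` gives the same value). -/
def action {n k : ℕ} (Λ : Weights n k) (G : VectorMeasure X (symMat n))
    (q : VectorMeasure X (Matrix (Fin n) (Fin k) ℝ))
    (R : VectorMeasure X (Matrix (Fin n) (Fin n) ℝ)) : ℝ≥0∞ :=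
  ∫⁻ x, (suppO Λ (dens (toMat G) (refTriple G q R) x) (dens q (refTriple G q R) x)
    (dens R (refTriple G q R) x)).toENNReal ∂(refTriple G q R)

/-! ### The Hilbert space `L²_{G,Λ}` -/

open Classical in
/-- The density of `G` with respect to its reference measure. For an `𝕊ⁿ₊`-valued `G` it is positive
semidefinite almost everywhere; the version chosen here is positive semidefinite everywhere. -/
def psdDens {n : ℕ} (G : VectorMeasure X (symMat n)) (x : X) : Matrix (Fin n) (Fin n) ℝ :=
  if (dens (toMat G) (refMeasure (toMat G)) x).PosSemidef then
    dens (toMat G) (refMeasure (toMat G)) x else 0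

/-- The pointwise weighted form `(u Λ₁†) · M (u' Λ₁†) + (W Λ₂⁻¹) · M (W' Λ₂⁻¹)`. -/
def wForm {n k : ℕ} (Λ : Weights n k) (M : Matrix (Fin n) (Fin n) ℝ)
    (v w : Matrix (Fin n) (Fin k) ℝ × Matrix (Fin n) (Fin n) ℝ) : ℝ :=
  frob (v.1 * pinv Λ.Λ₁) (M * (w.1 * pinv Λ.Λ₁)) + frob (v.2 * Λ.Λ₂⁻¹) (M * (w.2 * Λ.Λ₂⁻¹))

/-- The squared seminorm `‖(u, W)‖²_{L²_{G,Λ}}` of a field, in `[0, ∞]`. -/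
def sqNorm {n k : ℕ} (Λ : Weights n k) (G : VectorMeasure X (symMat n))
    (v : X → Matrix (Fin n) (Fin k) ℝ × Matrix (Fin n) (Fin n) ℝ) : ℝ≥0∞ :=
  ∫⁻ x, ENNReal.ofReal (wForm Λ (psdDens G x) (v x) (v x)) ∂(refMeasure (toMat G))

/-- Borel measurability of a matrix field (entry by entry). -/
def MeasField {n k : ℕ} (v : X → Matrix (Fin n) (Fin k) ℝ × Matrix (Fin n) (Fin n) ℝ) : Prop :=
  (∀ i j, Measurable fun x => (v x).1 i j) ∧ (∀ i j, Measurable fun x => (v x).2 i j)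

lemma frob_eq_sum {a b : ℕ} (A B : Matrix (Fin a) (Fin b) ℝ) :
    frob A B = ∑ j, ∑ i, A i j * B i j := by
  simp [frob, Matrix.trace, Matrix.mul_apply]

lemma frob_form_symm {a b : ℕ} {M : Matrix (Fin a) (Fin a) ℝ} (hM : M.IsSymm)
    (A B : Matrix (Fin a) (Fin b) ℝ) : frob A (M * B) = frob B (M * A) := by
  rw [frob, ← Matrix.trace_transpose]
  simp [frob, Matrix.mul_assoc, hM.eq]

lemma frob_form_nonneg {a b : ℕ} {M : Matrix (Fin a) (Fin a) ℝ} (hM : M.PosSemidef)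
    (A : Matrix (Fin a) (Fin b) ℝ) : 0 ≤ frob A (M * A) := by
  have := (hM.conjTranspose_mul_mul_same A).trace_nonneg
  simpa [frob, Matrix.mul_assoc] using this

lemma frob_add_left {a b : ℕ} (A A' B : Matrix (Fin a) (Fin b) ℝ) :
    frob (A + A') B = frob A B + frob A' B := by
  simp [frob, Matrix.add_mul]

lemma frob_smul_left {a b : ℕ} (c : ℝ) (A B : Matrix (Fin a) (Fin b) ℝ) :
    frob (c • A) B = c * frob A B := by
  simp [frob]

lemma psdDens_posSemidef {n : ℕ} (G : VectorMeasure X (symMat n)) (x : X) :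
    (psdDens G x).PosSemidef := by
  unfold psdDens
  split_ifs with h
  · exact h
  · exact Matrix.PosSemidef.zero

lemma psd_isSymm {n : ℕ} {M : Matrix (Fin n) (Fin n) ℝ} (h : M.PosSemidef) : M.IsSymm := by
  have := h.isHermitian
  rwa [Matrix.IsHermitian, Matrix.conjTranspose_eq_transpose_of_trivial] at this

lemma wForm_symm {n k : ℕ} (Λ : Weights n k) {M : Matrix (Fin n) (Fin n) ℝ} (hM : M.PosSemidef)
    (v w : Matrix (Fin n) (Fin k) ℝ × Matrix (Fin n) (Fin n) ℝ) :
    wForm Λ M v w = wForm Λ M w v := by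
  unfold wForm
  rw [frob_form_symm (psd_isSymm hM), frob_form_symm (psd_isSymm hM) (v.2 * _)]

lemma wForm_nonneg {n k : ℕ} (Λ : Weights n k) {M : Matrix (Fin n) (Fin n) ℝ} (hM : M.PosSemidef)
    (v : Matrix (Fin n) (Fin k) ℝ × Matrix (Fin n) (Fin n) ℝ) : 0 ≤ wForm Λ M v v :=
  add_nonneg (frob_form_nonneg hM _) (frob_form_nonneg hM _)

lemma wForm_add_left {n k : ℕ} (Λ : Weights n k) (M : Matrix (Fin n) (Fin n) ℝ)
    (v v' w : Matrix (Fin n) (Fin k) ℝ × Matrix (Fin n) (Fin n) ℝ) :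
    wForm Λ M (v + v') w = wForm Λ M v w + wForm Λ M v' w := by
  simp only [wForm, Prod.fst_add, Prod.snd_add, Matrix.add_mul, frob_add_left]
  ring

lemma wForm_smul_left {n k : ℕ} (Λ : Weights n k) (M : Matrix (Fin n) (Fin n) ℝ) (c : ℝ)
    (v w : Matrix (Fin n) (Fin k) ℝ × Matrix (Fin n) (Fin n) ℝ) :
    wForm Λ M (c • v) w = c * wForm Λ M v w := by
  simp only [wForm, Prod.smul_fst, Prod.smul_snd, Matrix.smul_mul, frob_smul_left]
  ring

lemma abs_wForm_le {n k : ℕ} (Λ : Weights n k) {M : Matrix (Fin n) (Fin n) ℝ}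
    (hM : M.PosSemidef) (v w : Matrix (Fin n) (Fin k) ℝ × Matrix (Fin n) (Fin n) ℝ) :
    |wForm Λ M v w| ≤ wForm Λ M v v + wForm Λ M w w := by
  have e1 : ∀ c : ℝ, wForm Λ M (v + c • w) (v + c • w)
      = wForm Λ M v v + 2 * c * wForm Λ M v w + c ^ 2 * wForm Λ M w w := fun c => by
    rw [wForm_add_left, wForm_symm Λ hM v, wForm_symm Λ hM (c • w), wForm_add_left,
      wForm_add_left, wForm_smul_left, wForm_symm Λ hM v (c • w), wForm_smul_left,
      wForm_smul_left, wForm_symm Λ hM w (c • w), wForm_smul_left, wForm_symm Λ hM w v]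
    ring
  have h1 := wForm_nonneg Λ hM (v + (1 : ℝ) • w)
  have h2 := wForm_nonneg Λ hM (v + (-1 : ℝ) • w)
  have h3 := wForm_nonneg Λ hM v
  have h4 := wForm_nonneg Λ hM w
  rw [e1] at h1 h2
  rw [abs_le]
  constructor <;> nlinarith

instance {a b : ℕ} (μ : VectorMeasure X (Matrix (Fin a) (Fin b) ℝ)) :
    IsFiniteMeasure (refMeasure μ) := by
  unfold refMeasure
  have : ∀ i, IsFiniteMeasure (∑ j, (entry μ i j).totalVariation) := fun i => inferInstance
  infer_instance

lemma isClosed_posSemidef (n : ℕ) :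
    IsClosed {f : Fin n → Fin n → ℝ | (Matrix.of f).PosSemidef} := by
  have : {f : Fin n → Fin n → ℝ | (Matrix.of f).PosSemidef} =
      (⋂ i, ⋂ j, {f | f i j = f j i}) ∩ ⋂ v : Fin n → ℝ, {f | 0 ≤ ∑ i, v i * ∑ j, f i j * v j} := by
    ext f
    simp only [Set.mem_ofPred_eq, Matrix.posSemidef_iff_dotProduct_mulVec, Set.mem_inter_iff,
      Set.mem_iInter]
    refine and_congr ?_ ?_
    · rw [Matrix.IsHermitian, ← Matrix.ext_iff]
      simp only [Matrix.conjTranspose_apply, Matrix.of_apply, star_trivial]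
      exact ⟨fun h i j => (h i j).symm, fun h i j => (h i j).symm⟩
    · simp [dotProduct, Matrix.mulVec]
  rw [this]
  refine IsClosed.inter ?_ ?_
  · exact isClosed_iInter fun i => isClosed_iInter fun j =>
      isClosed_eq (by fun_prop) (by fun_prop)
  · exact isClosed_iInter fun v => isClosed_le (by fun_prop) (by fun_prop)

lemma measurableSet_densPSD {n : ℕ} (G : VectorMeasure X (symMat n)) :
    MeasurableSet {x | (dens (toMat G) (refMeasure (toMat G)) x).PosSemidef} := by
  have h : Measurable fun (x : X) (i j : Fin n) =>
      (entry (toMat G) i j).rnDeriv (refMeasure (toMat G)) x :=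
    measurable_pi_lambda _ fun i => measurable_pi_lambda _ fun j =>
      SignedMeasure.measurable_rnDeriv _ _
  exact h (isClosed_posSemidef n).measurableSet

lemma psdDens_apply {n : ℕ} (G : VectorMeasure X (symMat n)) (i j : Fin n) :
    (fun x => psdDens G x i j) =
      {x | (dens (toMat G) (refMeasure (toMat G)) x).PosSemidef}.indicator
        ((entry (toMat G) i j).rnDeriv (refMeasure (toMat G))) := by
  classical
  funext x
  unfold psdDens Set.indicator
  simp only [Set.mem_ofPred_eq]
  split_ifs <;> simp [dens]

lemma measurable_psdDens {n : ℕ} (G : VectorMeasure X (symMat n)) (i j : Fin n) :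
    Measurable fun x => psdDens G x i j := by
  rw [psdDens_apply]
  exact (SignedMeasure.measurable_rnDeriv _ _).indicator (measurableSet_densPSD G)

lemma integrable_psdDens {n : ℕ} (G : VectorMeasure X (symMat n)) (i j : Fin n) :
    Integrable (fun x => psdDens G x i j) (refMeasure (toMat G)) := by
  rw [psdDens_apply]
  exact (SignedMeasure.integrable_rnDeriv _ _).indicator (measurableSet_densPSD G)

lemma measurable_frob {n a : ℕ} {M : X → Matrix (Fin n) (Fin n) ℝ}
    {A B : X → Matrix (Fin n) (Fin a) ℝ} (hM : ∀ i j, Measurable fun x => M x i j)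
    (hA : ∀ i j, Measurable fun x => A x i j) (hB : ∀ i j, Measurable fun x => B x i j) :
    Measurable fun x => frob (A x) (M x * B x) := by
  simp only [frob_eq_sum, Matrix.mul_apply]
  exact Finset.measurable_fun_sum _ fun j _ => Finset.measurable_fun_sum _ fun i _ =>
    (hA i j).mul (Finset.measurable_fun_sum _ fun l _ => (hM i l).mul (hB l j))

lemma measurable_mul_const {n a b : ℕ} {A : X → Matrix (Fin n) (Fin a) ℝ}
    (hA : ∀ i j, Measurable fun x => A x i j) (L : Matrix (Fin a) (Fin b) ℝ) (i : Fin n)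
    (j : Fin b) : Measurable fun x => (A x * L) i j := by
  simp only [Matrix.mul_apply]
  exact Finset.measurable_fun_sum _ fun l _ => (hA i l).mul_const _

lemma measurable_wForm {n k : ℕ} (Λ : Weights n k) (G : VectorMeasure X (symMat n))
    {v w : X → Matrix (Fin n) (Fin k) ℝ × Matrix (Fin n) (Fin n) ℝ} (hv : MeasField v)
    (hw : MeasField w) : Measurable fun x => wForm Λ (psdDens G x) (v x) (w x) :=
  (measurable_frob (measurable_psdDens G) (measurable_mul_const hv.1 _)
    (measurable_mul_const hw.1 _)).add
  (measurable_frob (measurable_psdDens G) (measurable_mul_const hv.2 _)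
    (measurable_mul_const hw.2 _))

lemma integrable_wForm {n k : ℕ} {Λ : Weights n k} {G : VectorMeasure X (symMat n)}
    {v w : X → Matrix (Fin n) (Fin k) ℝ × Matrix (Fin n) (Fin n) ℝ}
    (hv : MeasField v ∧ sqNorm Λ G v < ⊤) (hw : MeasField w ∧ sqNorm Λ G w < ⊤) :
    Integrable (fun x => wForm Λ (psdDens G x) (v x) (w x)) (refMeasure (toMat G)) := by
  have key : ∀ {u : X → Matrix (Fin n) (Fin k) ℝ × Matrix (Fin n) (Fin n) ℝ},
      MeasField u ∧ sqNorm Λ G u < ⊤ →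
      Integrable (fun x => wForm Λ (psdDens G x) (u x) (u x)) (refMeasure (toMat G)) :=
    fun {u} hu => ⟨(measurable_wForm Λ G hu.1 hu.1).aestronglyMeasurable, by
      rw [hasFiniteIntegral_iff_ofReal
        (Filter.Eventually.of_forall fun x => wForm_nonneg Λ (psdDens_posSemidef G x) _)]
      exact hu.2⟩
  refine ((key hv).add (key hw)).mono' (measurable_wForm Λ G hv.1 hw.1).aestronglyMeasurable ?_
  exact Filter.Eventually.of_forall fun x => abs_wForm_le Λ (psdDens_posSemidef G x) _ _

/-- The Borel fields `(u, W)` with values in `ℝⁿˣᵏ × 𝕄ⁿ` and finite seminorm. -/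
def fieldSpace {n k : ℕ} (Λ : Weights n k) (G : VectorMeasure X (symMat n)) :
    Submodule ℝ (X → Matrix (Fin n) (Fin k) ℝ × Matrix (Fin n) (Fin n) ℝ) where
  carrier := {v | MeasField v ∧ sqNorm Λ G v < ⊤}
  zero_mem' := by
    refine ⟨⟨fun i j => ?_, fun i j => ?_⟩, ?_⟩
    · simp
    · simp
    · simp [sqNorm, wForm, frob]
  add_mem' := by
    intro v w hv hw
    refine ⟨⟨fun i j => (hv.1.1 i j).add (hw.1.1 i j), fun i j => (hv.1.2 i j).add (hw.1.2 i j)⟩,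
      ?_⟩
    have hb : ∀ x, wForm Λ (psdDens G x) ((v + w) x) ((v + w) x) =
        wForm Λ (psdDens G x) (v x) (v x) + 2 * wForm Λ (psdDens G x) (v x) (w x)
          + wForm Λ (psdDens G x) (w x) (w x) := fun x => by
      have hM := psdDens_posSemidef G x
      rw [Pi.add_apply, wForm_add_left, wForm_symm Λ hM (v x), wForm_symm Λ hM (w x) (_ + _),
        wForm_add_left, wForm_add_left, wForm_symm Λ hM (w x) (v x)]
      ring
    have hi : Integrable (fun x => wForm Λ (psdDens G x) ((v + w) x) ((v + w) x))
        (refMeasure (toMat G)) := by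
      simp only [hb]
      exact ((integrable_wForm hv hv).add ((integrable_wForm hv hw).const_mul 2)).add
        (integrable_wForm hw hw)
    exact (hasFiniteIntegral_iff_ofReal (Filter.Eventually.of_forall fun x =>
      wForm_nonneg Λ (psdDens_posSemidef G x) _)).1 hi.2
  smul_mem' := by
    intro c v hv
    refine ⟨⟨fun i j => (hv.1.1 i j).const_mul c, fun i j => (hv.1.2 i j).const_mul c⟩, ?_⟩
    have hb : ∀ x, wForm Λ (psdDens G x) ((c • v) x) ((c • v) x) =
        c ^ 2 * wForm Λ (psdDens G x) (v x) (v x) := fun x => by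
      have hM := psdDens_posSemidef G x
      rw [Pi.smul_apply, wForm_smul_left, wForm_symm Λ hM (v x), wForm_smul_left]
      ring
    have hi : Integrable (fun x => wForm Λ (psdDens G x) ((c • v) x) ((c • v) x))
        (refMeasure (toMat G)) := by
      simp only [hb]
      exact (integrable_wForm hv hv).const_mul _
    exact (hasFiniteIntegral_iff_ofReal (Filter.Eventually.of_forall fun x =>
      wForm_nonneg Λ (psdDens_posSemidef G x) _)).1 hi.2

/-- The space of Borel fields of finite seminorm, carrying the semi-inner product of `L²_{G,Λ}`. -/
def PreL2 {n k : ℕ} (Λ : Weights n k) (G : VectorMeasure X (symMat n)) : Type _ :=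
  fieldSpace Λ G

instance {n k : ℕ} (Λ : Weights n k) (G : VectorMeasure X (symMat n)) :
    AddCommGroup (PreL2 Λ G) :=
  inferInstanceAs (AddCommGroup (fieldSpace Λ G))

instance {n k : ℕ} (Λ : Weights n k) (G : VectorMeasure X (symMat n)) :
    Module ℝ (PreL2 Λ G) :=
  inferInstanceAs (Module ℝ (fieldSpace Λ G))

/-- The semi-inner product
`⟨(u, W), (u', W')⟩ = ∫ (u Λ₁†) · G (u' Λ₁†) + (W Λ₂⁻¹) · G (W' Λ₂⁻¹)` of `L²_{G,Λ}`. -/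
instance preL2Core {n k : ℕ} (Λ : Weights n k) (G : VectorMeasure X (symMat n)) :
    PreInnerProductSpace.Core ℝ (PreL2 Λ G) where
  inner v w := ∫ x, wForm Λ (psdDens G x) (v.1 x) (w.1 x) ∂(refMeasure (toMat G))
  conj_inner_symm v w := by
    simp only [conj_trivial]
    exact integral_congr_ae (Filter.Eventually.of_forall fun x =>
      wForm_symm Λ (psdDens_posSemidef G x) _ _)
  re_inner_nonneg v := by
    exact integral_nonneg fun x => wForm_nonneg Λ (psdDens_posSemidef G x) _
  add_left v v' w := by
    rw [← integral_add (integrable_wForm v.2 w.2) (integrable_wForm v'.2 w.2)]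
    exact integral_congr_ae (Filter.Eventually.of_forall fun x => wForm_add_left Λ _ _ _ _)
  smul_left v w c := by
    simp only [conj_trivial]
    rw [← integral_const_mul]
    exact integral_congr_ae (Filter.Eventually.of_forall fun x => wForm_smul_left Λ _ _ _ _)

instance {n k : ℕ} (Λ : Weights n k) (G : VectorMeasure X (symMat n)) :
    SeminormedAddCommGroup (PreL2 Λ G) :=
  InnerProductSpace.Core.toSeminormedAddCommGroup (𝕜 := ℝ)

instance {n k : ℕ} (Λ : Weights n k) (G : VectorMeasure X (symMat n)) :
    InnerProductSpace ℝ (PreL2 Λ G) :=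
  InnerProductSpace.ofCore (preL2Core Λ G)

/-- The Hilbert space `L²_{G,Λ}`: fields of finite seminorm modulo fields of seminorm zero. -/
abbrev L2 {n k : ℕ} (Λ : Weights n k) (G : VectorMeasure X (symMat n)) : Type _ :=
  SeparationQuotient (PreL2 Λ G)

/-- The class in `L²_{G,Λ}` of a field of finite seminorm. -/
def L2.mk {n k : ℕ} (Λ : Weights n k) (G : VectorMeasure X (symMat n)) :
    fieldSpace Λ G →ₗ[ℝ] L2 Λ G where
  toFun v := SeparationQuotient.mk (show PreL2 Λ G from v)
  map_add' _ _ := rfl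
  map_smul' _ _ := rfl

end Measures

/-! ### The time-space domain, test fields and the differential operator -/

/-- A bounded open convex subset of `ℝᵈ`; the spatial domain is its closure. -/
structure ConvexDomain (d : ℕ) where
  inner : Set (EuclideanSpace ℝ (Fin d))
  isOpen : IsOpen inner
  convex : Convex ℝ inner
  isBounded : Bornology.IsBounded inner

/-- The spatial domain `Ω`. -/
def ConvexDomain.Ω {d : ℕ} (S : ConvexDomain d) : Set (EuclideanSpace ℝ (Fin d)) :=
  closure S.inner

/-- The time-space domain `Q = [0, 1] × Ω`. -/
def ConvexDomain.Q {d : ℕ} (S : ConvexDomain d) : Set (ℝ × EuclideanSpace ℝ (Fin d)) :=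
  Icc 0 1 ×ˢ S.Ω

lemma ConvexDomain.uniqueDiffOn_Q {d : ℕ} (S : ConvexDomain d) : UniqueDiffOn ℝ S.Q := by
  rcases S.inner.eq_empty_or_nonempty with h | h
  · have : S.Q = ∅ := by simp [ConvexDomain.Q, ConvexDomain.Ω, h]
    rw [this]; exact uniqueDiffOn_empty
  · refine (uniqueDiffOn_Icc zero_lt_one).prod (uniqueDiffOn_convex S.convex.closure ?_)
    exact h.mono (interior_maximal subset_closure S.isOpen)

lemma ConvexDomain.isCompact_Q {d : ℕ} (S : ConvexDomain d) : IsCompact S.Q :=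
  isCompact_Icc.prod S.isBounded.isCompact_closure

/-- The space `C¹(Q, 𝕊ⁿ)`. -/
def C1 {d : ℕ} (S : ConvexDomain d) (n : ℕ) :
    Submodule ℝ (ℝ × EuclideanSpace ℝ (Fin d) → symMat n) where
  carrier := {Φ | ContDiffOn ℝ 1 Φ S.Q}
  add_mem' h h' := h.add h'
  zero_mem' := contDiffOn_const
  smul_mem' c _ h := h.const_smul c

/-- A first-order constant-coefficient linear differential operator
`D* Φ = D₀* Φ + ∑ⱼ D₁ⱼ* ∂ⱼΦ` from `𝕊ⁿ`-valued to `ℝⁿˣᵏ`-valued functions of `x ∈ ℝᵈ`,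
with `D*(I) = D₀*(I) = 0`. -/
structure FirstOrderOp (d n k : ℕ) where
  zeroth : symMat n →ₗ[ℝ] Matrix (Fin n) (Fin k) ℝ
  first : Fin d → symMat n →ₗ[ℝ] Matrix (Fin n) (Fin k) ℝ
  map_one : zeroth (symOne n) = 0

/-- The time derivative `∂ₜΦ` on `Q`. -/
def dt {d n : ℕ} (S : ConvexDomain d) (Φ : ℝ × EuclideanSpace ℝ (Fin d) → symMat n)
    (z : ℝ × EuclideanSpace ℝ (Fin d)) : symMat n :=
  fderivWithin ℝ Φ S.Q z (1, 0)

/-- The spatial partial derivative `∂ⱼΦ` on `Q`. -/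
def dx {d n : ℕ} (S : ConvexDomain d) (j : Fin d) (Φ : ℝ × EuclideanSpace ℝ (Fin d) → symMat n)
    (z : ℝ × EuclideanSpace ℝ (Fin d)) : symMat n :=
  fderivWithin ℝ Φ S.Q z (0, EuclideanSpace.single j 1)

/-- `D* Φ` on `Q`, the operator acting on the spatial variable. -/
def FirstOrderOp.app {d n k : ℕ} (D : FirstOrderOp d n k) (S : ConvexDomain d)
    (Φ : ℝ × EuclideanSpace ℝ (Fin d) → symMat n) (z : ℝ × EuclideanSpace ℝ (Fin d)) :
    Matrix (Fin n) (Fin k) ℝ :=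
  D.zeroth (Φ z) + ∑ j, D.first j (dx S j Φ z)

section Problem

variable {d n k : ℕ} (S : ConvexDomain d) (D : FirstOrderOp d n k) (Λ : Weights n k)
  (G₀ G₁ : VectorMeasure S.Ω (symMat n))

/-- The functional
`l_G(Φ) = ⟨G₁, Φ(1, ·)⟩_Ω - ⟨G₀, Φ(0, ·)⟩_Ω - ⟨G, ∂ₜΦ⟩_Q`. -/
def lG (G : VectorMeasure S.Q (symMat n)) (Φ : C1 S n) : ℝ :=
  pairing (toMat G₁) (fun x => (Φ.1 (1, x) : Matrix (Fin n) (Fin n) ℝ))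
    - pairing (toMat G₀) (fun x => (Φ.1 (0, x) : Matrix (Fin n) (Fin n) ℝ))
    - pairing (toMat G) (fun z => (dt S Φ.1 z : Matrix (Fin n) (Fin n) ℝ))

/-- `(G, q, R) ∈ CE([0,1]; G₀, G₁)`: the weak form of the continuity equation
`∂ₜG + D q = Rˢʸᵐ + δ₀ ⊗ G₀ - δ₁ ⊗ G₁`, tested against `C¹(Q, 𝕊ⁿ)`. -/
def IsCE (G : VectorMeasure S.Q (symMat n))
    (q : VectorMeasure S.Q (Matrix (Fin n) (Fin k) ℝ))
    (R : VectorMeasure S.Q (Matrix (Fin n) (Fin n) ℝ)) : Prop :=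
  ∀ Φ : C1 S n,
    pairing (toMat G) (fun z => (dt S Φ.1 z : Matrix (Fin n) (Fin n) ℝ))
      + pairing q (fun z => D.app S Φ.1 z)
      + pairing R (fun z => (Φ.1 z : Matrix (Fin n) (Fin n) ℝ))
    = pairing (toMat G₁) (fun x => (Φ.1 (1, x) : Matrix (Fin n) (Fin n) ℝ))
      - pairing (toMat G₀) (fun x => (Φ.1 (0, x) : Matrix (Fin n) (Fin n) ℝ))

/-- `(G, q, R) ∈ CE_∞([0,1]; G₀, G₁)`: solutions of the continuity equation of finite action. -/
def IsCEFin (G : VectorMeasure S.Q (symMat n))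
    (q : VectorMeasure S.Q (Matrix (Fin n) (Fin k) ℝ))
    (R : VectorMeasure S.Q (Matrix (Fin n) (Fin n) ℝ)) : Prop :=
  IsCE S D G₀ G₁ G q R ∧ action Λ G q R < ⊤

/-- The squared weighted Wasserstein–Bures distance: the infimum of the action over
`CE([0,1]; G₀, G₁)`. -/
def WBsq : ℝ≥0∞ :=
  ⨅ (G : VectorMeasure S.Q (symMat n)) (q : VectorMeasure S.Q (Matrix (Fin n) (Fin k) ℝ))
    (R : VectorMeasure S.Q (Matrix (Fin n) (Fin n) ℝ)) (_ : IsCE S D G₀ G₁ G q R), action Λ G q R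

/-- The set `AC([0,1])` of all `G` that belong to some `(G, q, R) ∈ CE_∞([0,1]; G₀, G₁)`. -/
def AC : Set (VectorMeasure S.Q (symMat n)) :=
  {G | ∃ q R, IsCEFin S D Λ G₀ G₁ G q R}

/-- The field `(G† q, G† R)` built from the densities of `G`, `q`, `R`. -/
def pinvField (G : VectorMeasure S.Q (symMat n))
    (q : VectorMeasure S.Q (Matrix (Fin n) (Fin k) ℝ))
    (R : VectorMeasure S.Q (Matrix (Fin n) (Fin n) ℝ)) (z : S.Q) :
    Matrix (Fin n) (Fin k) ℝ × Matrix (Fin n) (Fin n) ℝ :=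
  (pinv (dens (toMat G) (refTriple G q R) z) * dens q (refTriple G q R) z,
    pinv (dens (toMat G) (refTriple G q R) z) * dens R (refTriple G q R) z)

/-- The energy functional: the infimum of `½ ‖(G† q, G† R)‖²_{L²_{G,Λ}(Q)}` over all
`(q, R)` with `(G, q, R) ∈ CE_∞([0,1]; G₀, G₁)`. -/
def energy (G : VectorMeasure S.Q (symMat n)) : ℝ≥0∞ :=
  ⨅ (q : VectorMeasure S.Q (Matrix (Fin n) (Fin k) ℝ))
    (R : VectorMeasure S.Q (Matrix (Fin n) (Fin n) ℝ)) (_ : IsCEFin S D Λ G₀ G₁ G q R),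
    (1 / 2) * sqNorm Λ G (pinvField S G q R)

/-- The field `(D*Φ Λ₁², Φ Λ₂²)` on `Q`. -/
def tField (Φ : ℝ × EuclideanSpace ℝ (Fin d) → symMat n) (z : S.Q) :
    Matrix (Fin n) (Fin k) ℝ × Matrix (Fin n) (Fin n) ℝ :=
  (D.app S Φ z * Λ.Λ₁ ^ 2, (Φ z : Matrix (Fin n) (Fin n) ℝ) * Λ.Λ₂ ^ 2)

lemma continuous_fderivWithin_Q (Φ : C1 S n) (v : ℝ × EuclideanSpace ℝ (Fin d)) :
    Continuous fun z : S.Q => fderivWithin ℝ Φ.1 S.Q z v := by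
  have h : ContinuousOn (fderivWithin ℝ Φ.1 S.Q) S.Q :=
    ContDiffOn.continuousOn_fderivWithin Φ.2 S.uniqueDiffOn_Q le_rfl
  exact (continuousOn_iff_continuous_domRestrict.1 h).clm_apply continuous_const

lemma continuous_tField (Φ : C1 S n) : Continuous (tField S D Λ Φ.1) := by
  have hΦ : Continuous fun z : S.Q => Φ.1 z :=
    continuousOn_iff_continuous_domRestrict.1 (ContDiffOn.continuousOn Φ.2)
  have h0 : Continuous fun z : S.Q => D.app S Φ.1 z := by
    unfold FirstOrderOp.app dx
    exact (D.zeroth.continuous_of_finiteDimensional.comp hΦ).add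
      (continuous_finsetSum _ fun j _ =>
        (D.first j).continuous_of_finiteDimensional.comp (continuous_fderivWithin_Q S Φ _))
  exact (h0.matrix_mul continuous_const).prodMk
    ((continuous_subtype_val.comp hΦ).matrix_mul continuous_const)

lemma tField_mem (G : VectorMeasure S.Q (symMat n)) (Φ : C1 S n) :
    tField S D Λ Φ.1 ∈ fieldSpace Λ G := by
  have : CompactSpace S.Q := isCompact_iff_compactSpace.1 S.isCompact_Q
  have hc := continuous_tField S D Λ Φ
  have hc1 : ∀ i j, Continuous fun z => (tField S D Λ Φ.1 z).1 i j := fun i j =>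
    hc.fst.matrix_elem i j
  have hc2 : ∀ i j, Continuous fun z => (tField S D Λ Φ.1 z).2 i j := fun i j =>
    hc.snd.matrix_elem i j
  have hm : MeasField (tField S D Λ Φ.1) :=
    ⟨fun i j => (hc1 i j).measurable, fun i j => (hc2 i j).measurable⟩
  refine ⟨hm, ?_⟩
  have key : ∀ {b : ℕ} (A : S.Q → Matrix (Fin n) (Fin b) ℝ), Continuous A →
      Integrable (fun z => frob (A z) (psdDens G z * A z)) (refMeasure (toMat G)) := by
    intro b A hA
    simp only [frob_eq_sum, Matrix.mul_apply, Finset.mul_sum]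
    refine integrable_finsetSum _ fun j _ => integrable_finsetSum _ fun i _ =>
      integrable_finsetSum _ fun l _ => ?_
    have e : (fun z => A z i j * (psdDens G z i l * A z l j)) =
        fun z => (A z i j * A z l j) * psdDens G z i l := by funext z; ring
    rw [e]
    have hcont : Continuous fun z => A z i j * A z l j :=
      (hA.matrix_elem i j).mul (hA.matrix_elem l j)
    obtain ⟨C, hC⟩ := isCompact_univ.exists_bound_of_continuousOn hcont.continuousOn
    exact (integrable_psdDens G i l).bdd_mul hcont.measurable.aestronglyMeasurable
      (Filter.Eventually.of_forall fun z => hC z (mem_univ z))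
  have hi : Integrable (fun z => wForm Λ (psdDens G z) (tField S D Λ Φ.1 z)
      (tField S D Λ Φ.1 z)) (refMeasure (toMat G)) :=
    (key _ (hc.fst.matrix_mul continuous_const)).add (key _ (hc.snd.matrix_mul continuous_const))
  exact (hasFiniteIntegral_iff_ofReal (Filter.Eventually.of_forall fun z =>
    wForm_nonneg Λ (psdDens_posSemidef G z) _)).1 hi.2

/-- The linear map `Φ ↦ (D*Φ Λ₁², Φ Λ₂²)` from `C¹(Q, 𝕊ⁿ)` to `L²_{G,Λ}(Q)`. -/
def T (G : VectorMeasure S.Q (symMat n)) : C1 S n →ₗ[ℝ] L2 Λ G :=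
  L2.mk Λ G ∘ₗ
  { toFun := fun Φ => ⟨tField S D Λ Φ.1, tField_mem S D Λ G Φ⟩
    map_add' := fun Φ Ψ => by
      refine Subtype.ext (funext fun z => ?_)
      have h1 := ContDiffOn.differentiableOn Φ.2 one_ne_zero z z.2
      have h2 := ContDiffOn.differentiableOn Ψ.2 one_ne_zero z z.2
      have h3 : ∀ v, fderivWithin ℝ (Φ.1 + Ψ.1) S.Q z v =
          fderivWithin ℝ Φ.1 S.Q z v + fderivWithin ℝ Ψ.1 S.Q z v := fun v => by
        exact DFunLike.congr_fun (fderivWithin_add (S.uniqueDiffOn_Q z z.2) h1 h2) v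
      refine Prod.ext ?_ ?_
      · simp only [tField, FirstOrderOp.app, dx, Submodule.coe_add, Pi.add_apply, h3, map_add,
          Finset.sum_add_distrib, Prod.fst_add, ← Matrix.add_mul]
        congr 1; abel
      · simp [tField, Matrix.add_mul]
    map_smul' := fun c Φ => by
      refine Subtype.ext (funext fun z => ?_)
      have h1 := ContDiffOn.differentiableOn Φ.2 one_ne_zero z z.2
      have h3 : ∀ v, fderivWithin ℝ (c • Φ.1) S.Q z v = c • fderivWithin ℝ Φ.1 S.Q z v := fun v => by
        exact DFunLike.congr_fun (fderivWithin_const_smul (S.uniqueDiffOn_Q z z.2) h1 c) v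
      refine Prod.ext ?_ ?_
      · simp only [tField, FirstOrderOp.app, dx, Submodule.coe_smul, Pi.smul_apply, h3, map_smul,
          ← Finset.smul_sum, ← smul_add, Matrix.smul_mul, RingHom.id_apply, Prod.smul_fst]
      · simp [tField] }

/-- The space `H_{G,Λ}(D*)`: the closure of `{(D*Φ Λ₁², Φ Λ₂²) : Φ ∈ C¹(Q, 𝕊ⁿ)}` in
`L²_{G,Λ}(Q)`. -/
def H (G : VectorMeasure S.Q (symMat n)) : Submodule ℝ (L2 Λ G) :=
  (LinearMap.range (T S D Λ G)).topologicalClosure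

/-- `(D*Φ Λ₁², Φ Λ₂²)` as an element of `H_{G,Λ}(D*)`. -/
def TH (G : VectorMeasure S.Q (symMat n)) (Φ : C1 S n) : H S D Λ G :=
  ⟨T S D Λ G Φ, Submodule.le_topologicalClosure _ (LinearMap.mem_range_self _ Φ)⟩

/-- The constraint set of the minimum norm problem: all `(u, W) ∈ L²_{G,Λ}(Q)` with
`⟨(D*Φ Λ₁², Φ Λ₂²), (u, W)⟩ = l_G(Φ)` for every `Φ ∈ C¹(Q, 𝕊ⁿ)`. -/
def constraintSet (G : VectorMeasure S.Q (symMat n)) : Set (L2 Λ G) :=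
  {w | ∀ Φ : C1 S n, ⟪T S D Λ G Φ, w⟫ = lG S G₀ G₁ G Φ}

end Problem

end

/-!
Fix `G` and write `M` for its density. On triplets `(M, M u Λ₁† Λ₁, M W)` with `M ≽ 0` the support
function `J_Λ` equals half the quadratic form `wForm` at `(u, W)`, and `J_Λ` is finite only at
triplets of this shape, with `u = M† Y` and `W = M† Z` (`suppO_eq_half_wForm`, `suppO_lt_top`).
Hence the action of `(G, q, R)`, if finite, is `½ ‖(G† q, G† R)‖²` in `L²_{G,Λ}`. This gives the
formula for `WBsq` at once, the energy being an infimum over `(q, R)` with `G` held fixed.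

The notion tying measures to fields is `Represents`: a field `(u, W)` represents `(q, R)` when
`q = G u Λ₁† Λ₁` and `R = G W` as densities. Testing `(q, R)` against `(D*Φ, Φ)` is then the inner
product of `(u, W)` with `(D*Φ Λ₁², Φ Λ₂²)`, because `Λ₁² Λ₁† = Λ₁`
(`Represents.integral_wForm_eq`).
So `(q, R)` solves the continuity equation if and only if `(u, W)` lies in the constraint set of the
minimum norm problem (`mem_constraintSet_iff_isCE`). A pair `(q, R)` of finite action is
represented by `(G† q, G† R)`, and conversely every field of finite seminorm represents some pair
(`exists_represents`). The energy is therefore the value of the minimum norm problem.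

The rest is Hilbert space theory. The space `L²_{G,Λ}` is complete (`PreL2.completeSpace`), so the
orthogonal projection `v` of any `(G† q, G† R)` onto `H_{G,Λ}(D*)` exists; it still satisfies the
constraint, represents the functional `l_G`, and is the unique element of least norm in the
constraint set (`norm_sq_eq_of_mem_closure_range`). The dual formula is
`l_G(Φ) - ½ ‖T Φ‖² = ½ ‖v‖² - ½ ‖v - T Φ‖²` together with the density of the range of `T` in
`H_{G,Λ}(D*)` (`iSup_sub_half_norm_sq`).
-/

section

attribute [local instance] Matrix.frobeniusNormedAddCommGroup Matrix.frobeniusNormedSpace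

/-! ### The Frobenius product and weighted quadratic forms -/

lemma frob_comm {a b : ℕ} (A B : Matrix (Fin a) (Fin b) ℝ) : frob A B = frob B A := by
  simp only [frob_eq_sum, mul_comm]

lemma frob_add_right {a b : ℕ} (A B B' : Matrix (Fin a) (Fin b) ℝ) :
    frob A (B + B') = frob A B + frob A B' := by
  simp [frob, Matrix.mul_add]

lemma frob_smul_right {a b : ℕ} (c : ℝ) (A B : Matrix (Fin a) (Fin b) ℝ) :
    frob A (c • B) = c * frob A B := by
  simp [frob]

lemma frob_neg_right {a b : ℕ} (A B : Matrix (Fin a) (Fin b) ℝ) :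
    frob A (-B) = -frob A B := by
  simp [frob]

lemma frob_sub_right {a b : ℕ} (A B B' : Matrix (Fin a) (Fin b) ℝ) :
    frob A (B - B') = frob A B - frob A B' := by
  simp [frob, Matrix.mul_sub]

lemma frob_mul_left {a b c : ℕ} (M : Matrix (Fin a) (Fin c) ℝ) (A : Matrix (Fin c) (Fin b) ℝ)
    (B : Matrix (Fin a) (Fin b) ℝ) : frob (M * A) B = frob A (Mᵀ * B) := by
  simp [frob, Matrix.mul_assoc]

lemma frob_mul_right {a b c : ℕ} (A : Matrix (Fin a) (Fin c) ℝ) (L : Matrix (Fin c) (Fin b) ℝ)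
    (B : Matrix (Fin a) (Fin b) ℝ) : frob (A * L) B = frob A (B * Lᵀ) := by
  rw [frob, frob, Matrix.transpose_mul, Matrix.mul_assoc, Matrix.trace_mul_comm, Matrix.mul_assoc]

lemma frob_self_eq_zero {a b : ℕ} {A : Matrix (Fin a) (Fin b) ℝ} (h : frob A A = 0) : A = 0 := by
  have := Matrix.trace_conjTranspose_mul_self_eq_zero_iff (A := A)
  rw [Matrix.conjTranspose_eq_transpose_of_trivial] at this
  exact this.1 h

lemma frob_single {a b : ℕ} (i : Fin a) (j : Fin b) (B : Matrix (Fin a) (Fin b) ℝ) :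
    frob (Matrix.single i j 1) B = B i j := by
  rw [frob_eq_sum, Finset.sum_eq_single j, Finset.sum_eq_single i]
  · simp
  · intro i' _ h; simp [Ne.symm h]
  · simp
  · intro j' _ h; simp [Ne.symm h]
  · simp

/-- Expansion of the quadratic form `A ↦ A · M A` of a symmetric matrix along a line. -/
lemma frob_form_add_smul {a b : ℕ} {M : Matrix (Fin a) (Fin a) ℝ} (hM : M.IsSymm)
    (A B : Matrix (Fin a) (Fin b) ℝ) (c : ℝ) :
    frob (A + c • B) (M * (A + c • B)) =
      frob A (M * A) + 2 * c * frob A (M * B) + c ^ 2 * frob B (M * B) := by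
  rw [Matrix.mul_add, Matrix.mul_smul, frob_add_left, frob_add_right, frob_add_right,
    frob_smul_right, frob_smul_right, frob_smul_left, frob_smul_left, frob_form_symm hM B A]
  ring

lemma frob_form_cauchySchwarz {a b : ℕ} {M : Matrix (Fin a) (Fin a) ℝ} (hM : M.PosSemidef)
    (A B : Matrix (Fin a) (Fin b) ℝ) :
    frob A (M * B) ^ 2 ≤ frob A (M * A) * frob B (M * B) := by
  have h := discrim_le_zero (a := frob B (M * B)) (b := 2 * frob A (M * B)) (c := frob A (M * A))
    fun t => by
      have := frob_form_nonneg hM (A + t • B)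
      rw [frob_form_add_smul (psd_isSymm hM)] at this
      linarith
  rw [discrim] at h
  nlinarith

/-- The entries of `M A` are controlled by the quadratic form of `M` at `A`. -/
lemma sq_mul_apply_le {a b : ℕ} {M : Matrix (Fin a) (Fin a) ℝ} (hM : M.PosSemidef)
    (A : Matrix (Fin a) (Fin b) ℝ) (i : Fin a) (j : Fin b) :
    (M * A) i j ^ 2 ≤ M i i * frob A (M * A) := by
  have h := frob_form_cauchySchwarz hM (Matrix.single i j 1) A
  rw [frob_single, frob_single] at h
  simpa [Matrix.mul_apply, Matrix.single_apply] using h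

lemma psd_diag_nonneg {a : ℕ} {M : Matrix (Fin a) (Fin a) ℝ} (hM : M.PosSemidef) (i : Fin a) :
    0 ≤ M i i := hM.diag_nonneg

lemma frob_nonneg_of_posSemidef {a : ℕ} {M N : Matrix (Fin a) (Fin a) ℝ} (hM : M.PosSemidef)
    (hN : N.PosSemidef) : 0 ≤ frob M N := by
  have h := hN.isHermitian.spectral_theorem
  rw [Unitary.conjStarAlgAut_apply, Matrix.star_eq_conjTranspose,
    Matrix.conjTranspose_eq_transpose_of_trivial] at h
  set P : Matrix (Fin a) (Fin a) ℝ := (hN.isHermitian.eigenvectorUnitary :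
    Matrix (Fin a) (Fin a) ℝ)
  have hPM := hM.conjTranspose_mul_mul_same P
  rw [Matrix.conjTranspose_eq_transpose_of_trivial] at hPM
  have e : frob M N = (Pᵀ * M * P * Matrix.diagonal hN.isHermitian.eigenvalues).trace := by
    rw [frob, (psd_isSymm hM).eq]
    conv_lhs => rw [h]
    rw [← Matrix.mul_assoc, Matrix.trace_mul_comm]
    simp only [Matrix.mul_assoc]
    rfl
  rw [e, Matrix.trace]
  refine Finset.sum_nonneg fun i _ => ?_
  rw [Matrix.diag_apply, Matrix.mul_diagonal]
  exact mul_nonneg hPM.diag_nonneg (hN.eigenvalues_nonneg i)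

lemma pinv_isSymm {a : ℕ} {A : Matrix (Fin a) (Fin a) ℝ} (hA : A.IsSymm) :
    (pinv A).IsSymm := by
  have hA' : A.IsHermitian := by
    rw [Matrix.IsHermitian, Matrix.conjTranspose_eq_transpose_of_trivial]; exact hA
  rw [pinv, dif_pos hA', Matrix.IsSymm, Matrix.transpose_mul, Matrix.transpose_mul,
    Matrix.transpose_transpose, Matrix.diagonal_transpose, Matrix.mul_assoc]

lemma pinv_mul_comm {a : ℕ} {A : Matrix (Fin a) (Fin a) ℝ} (hA : A.IsSymm) :
    pinv A * A = A * pinv A := by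
  have h := (pinv_penrose hA).1
  rw [Matrix.transpose_mul, hA.eq, (pinv_isSymm hA).eq] at h
  exact h.symm

lemma pinv_eq_inv {a : ℕ} {A : Matrix (Fin a) (Fin a) ℝ} (hA : A.PosDef) : pinv A = A⁻¹ := by
  have hu : IsUnit A.det := (Matrix.isUnit_iff_isUnit_det A).1 hA.isUnit
  have h := (pinv_penrose (psd_isSymm hA.posSemidef)).2.2.2
  have h2 : A⁻¹ * (A * pinv A * A) * A⁻¹ = A⁻¹ * A * A⁻¹ := by rw [h]
  rwa [Matrix.mul_assoc A, Matrix.nonsing_inv_mul_cancel_left _ _ hu,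
    Matrix.mul_nonsing_inv_cancel_right _ _ hu, Matrix.nonsing_inv_mul _ hu, Matrix.one_mul] at h2

lemma Weights.pinv_Λ₂_mul {n k : ℕ} (Λ : Weights n k) : pinv Λ.Λ₂ * Λ.Λ₂ = 1 := by
  rw [pinv_eq_inv Λ.posDef]
  exact Matrix.nonsing_inv_mul _ ((Matrix.isUnit_iff_isUnit_det _).1 Λ.posDef.isUnit)

lemma wForm_eq {n k : ℕ} (Λ : Weights n k) (M : Matrix (Fin n) (Fin n) ℝ)
    (v w : Matrix (Fin n) (Fin k) ℝ × Matrix (Fin n) (Fin n) ℝ) :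
    wForm Λ M v w = frob (v.1 * pinv Λ.Λ₁) (M * (w.1 * pinv Λ.Λ₁)) +
      frob (v.2 * pinv Λ.Λ₂) (M * (w.2 * pinv Λ.Λ₂)) := by
  rw [wForm, pinv_eq_inv Λ.posDef]

/-! ### The support function `J_Λ` -/

/-- For symmetric `L`, the pairing of `M u L† L` with `B` is the `M`-product of `u L†` and `B L`. -/
lemma frob_mul_pinv_mul {n b : ℕ} {M : Matrix (Fin n) (Fin n) ℝ} (hM : M.IsSymm)
    {L : Matrix (Fin b) (Fin b) ℝ} (hL : L.IsSymm) (u B : Matrix (Fin n) (Fin b) ℝ) :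
    frob (M * u * (pinv L * L)) B = frob (u * pinv L) (M * (B * L)) := by
  rw [← Matrix.mul_assoc, frob_mul_right, hL.eq, Matrix.mul_assoc, frob_mul_left, hM.eq]

lemma frob_mul_sq_mul {n b : ℕ} {M : Matrix (Fin n) (Fin n) ℝ} (hM : M.IsSymm)
    {L : Matrix (Fin b) (Fin b) ℝ} (hL : L.IsSymm) (B : Matrix (Fin n) (Fin b) ℝ) :
    frob M (B * L ^ 2 * Bᵀ) = frob (B * L) (M * (B * L)) := by
  have h : M * (B * L ^ 2 * Bᵀ) = M * B * L * (L * Bᵀ) := by simp only [sq, Matrix.mul_assoc]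
  rw [frob, frob, hM.eq, Matrix.transpose_mul, hL.eq, h, Matrix.trace_mul_comm]
  simp only [Matrix.mul_assoc]

lemma posSemidef_mul_sq_mul {n b : ℕ} {L : Matrix (Fin b) (Fin b) ℝ} (hL : L.IsSymm)
    (B : Matrix (Fin n) (Fin b) ℝ) : (B * L ^ 2 * Bᵀ).PosSemidef := by
  have h := Matrix.posSemidef_self_mul_conjTranspose (B * L)
  rw [Matrix.conjTranspose_eq_transpose_of_trivial, Matrix.transpose_mul, hL.eq] at h
  rw [sq]
  convert h using 1
  simp only [Matrix.mul_assoc]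

/-- The largest `A` with `(A, B, C) ∈ 𝒪_Λ` for given `B` and `C`. -/
noncomputable def topO {n k : ℕ} (Λ : Weights n k) (B : Matrix (Fin n) (Fin k) ℝ)
    (C : Matrix (Fin n) (Fin n) ℝ) : symMat n :=
  ⟨-((1 / 2 : ℝ) • (B * Λ.Λ₁ ^ 2 * Bᵀ) + (1 / 2 : ℝ) • (C * Λ.Λ₂ ^ 2 * Cᵀ)),
    (((psd_isSymm (posSemidef_mul_sq_mul (psd_isSymm Λ.posSemidef) B)).smul _).add
      ((psd_isSymm (posSemidef_mul_sq_mul (psd_isSymm Λ.posDef.posSemidef) C)).smul _)).neg⟩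

lemma topO_mem {n k : ℕ} (Λ : Weights n k) (B : Matrix (Fin n) (Fin k) ℝ)
    (C : Matrix (Fin n) (Fin n) ℝ) : (topO Λ B C, B, C) ∈ setO Λ := by
  simp only [setO, topO, Set.mem_ofPred_eq]
  convert Matrix.PosSemidef.zero using 1
  abel

lemma frob_topO {n k : ℕ} (Λ : Weights n k) {M : Matrix (Fin n) (Fin n) ℝ} (hM : M.IsSymm)
    (B : Matrix (Fin n) (Fin k) ℝ) (C : Matrix (Fin n) (Fin n) ℝ) :
    frob M (topO Λ B C : Matrix (Fin n) (Fin n) ℝ) =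
      -(1 / 2 * frob (B * Λ.Λ₁) (M * (B * Λ.Λ₁)) + 1 / 2 * frob (C * Λ.Λ₂) (M * (C * Λ.Λ₂))) := by
  simp only [topO, frob_neg_right, frob_add_right, frob_smul_right,
    frob_mul_sq_mul hM (psd_isSymm Λ.posSemidef),
    frob_mul_sq_mul hM (psd_isSymm Λ.posDef.posSemidef)]

lemma frob_le_of_mem_setO {n k : ℕ} (Λ : Weights n k) {M : Matrix (Fin n) (Fin n) ℝ}
    (hM : M.PosSemidef) {p : symMat n × Matrix (Fin n) (Fin k) ℝ × Matrix (Fin n) (Fin n) ℝ}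
    (hp : p ∈ setO Λ) :
    frob M (p.1 : Matrix (Fin n) (Fin n) ℝ) ≤
      frob M (topO Λ p.2.1 p.2.2 : Matrix (Fin n) (Fin n) ℝ) := by
  have h := frob_nonneg_of_posSemidef hM hp
  rw [frob_neg_right, add_assoc, frob_add_right] at h
  simp only [topO, frob_neg_right]
  linarith

/-- On triplets `(M, M u Λ₁† Λ₁, M W)` with `M ≽ 0`, the support function is half the quadratic form
of `L²_{G,Λ}`. The supremum is attained at `B Λ₁ = u Λ₁†`, `C Λ₂ = W Λ₂⁻¹`. -/
lemma suppO_eq_half_wForm {n k : ℕ} (Λ : Weights n k) {M : Matrix (Fin n) (Fin n) ℝ}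
    (hM : M.PosSemidef) (u : Matrix (Fin n) (Fin k) ℝ) (W : Matrix (Fin n) (Fin n) ℝ) :
    suppO Λ M (M * u * (pinv Λ.Λ₁ * Λ.Λ₁)) (M * W) =
      ((1 / 2 * wForm Λ M (u, W) (u, W) : ℝ) : EReal) := by
  have hs := psd_isSymm hM
  have hL₁ := psd_isSymm Λ.posSemidef
  have hL₂ := psd_isSymm Λ.posDef.posSemidef
  have hW : M * W = M * W * (pinv Λ.Λ₂ * Λ.Λ₂) := by rw [Λ.pinv_Λ₂_mul, Matrix.mul_one]
  rw [hW, wForm_eq]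
  refine le_antisymm (iSup₂_le fun p hp => EReal.coe_le_coe_iff.2 ?_) ?_
  · have h := frob_le_of_mem_setO Λ hM hp
    rw [frob_topO Λ hs] at h
    rw [frob_mul_pinv_mul hs hL₁, frob_mul_pinv_mul hs hL₂]
    have h1 := frob_form_nonneg hM (u * pinv Λ.Λ₁ + (-1 : ℝ) • (p.2.1 * Λ.Λ₁))
    have h2 := frob_form_nonneg hM (W * pinv Λ.Λ₂ + (-1 : ℝ) • (p.2.2 * Λ.Λ₂))
    rw [frob_form_add_smul hs] at h1 h2
    simp only
    linarith
  · refine le_iSup₂_of_le (topO Λ (u * pinv Λ.Λ₁ * pinv Λ.Λ₁) (W * pinv Λ.Λ₂ * pinv Λ.Λ₂),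
      u * pinv Λ.Λ₁ * pinv Λ.Λ₁, W * pinv Λ.Λ₂ * pinv Λ.Λ₂) (topO_mem _ _ _)
      (EReal.coe_le_coe_iff.2 ?_)
    have e : ∀ {b : ℕ} {L : Matrix (Fin b) (Fin b) ℝ} (hL : L.IsSymm)
        (u : Matrix (Fin n) (Fin b) ℝ), u * pinv L * pinv L * L = u * pinv L := fun hL u => by
      rw [Matrix.mul_assoc, pinv_mul_comm hL, Matrix.mul_assoc, ← Matrix.mul_assoc (pinv _),
        (pinv_penrose hL).2.2.1]
    rw [frob_mul_pinv_mul hs hL₁, frob_mul_pinv_mul hs hL₂, frob_topO Λ hs, e hL₁, e hL₂]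
    simp only
    linarith

lemma eq_zero_of_forall_mul_le {a c : ℝ} (h : ∀ s : ℝ, s * a ≤ c) : a = 0 := by
  by_contra ha
  have := h ((c + 1) / a)
  rw [div_mul_cancel₀ _ ha] at this
  linarith

/-- If `Y · B` vanishes for all `B` in the kernel of `B ↦ B L · M B L`, then `Y` has the form
`M y L† L`. -/
lemma eq_of_forall_frob_eq_zero {n b : ℕ} {M : Matrix (Fin n) (Fin n) ℝ} (hM : M.IsSymm)
    {L : Matrix (Fin b) (Fin b) ℝ} (hL : L.IsSymm) {Y : Matrix (Fin n) (Fin b) ℝ}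
    (h : ∀ B, frob (B * L) (M * (B * L)) = 0 → frob Y B = 0) :
    M * (pinv M * Y) = Y ∧ Y * (pinv L * L) = Y := by
  constructor
  · have h1 : M * (Y - M * (pinv M * Y)) = 0 := by
      rw [Matrix.mul_sub, ← Matrix.mul_assoc M (pinv M), ← pinv_mul_comm hM, ← Matrix.mul_assoc,
        ← Matrix.mul_assoc, (pinv_penrose hM).2.2.2, sub_self]
    have h2 := h (Y - M * (pinv M * Y)) (by
      rw [← Matrix.mul_assoc M (Y - _) L, h1, Matrix.zero_mul]; simp [frob])
    have h3 : frob (Y - M * (pinv M * Y)) (Y - M * (pinv M * Y)) = 0 := by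
      have h4 : frob (M * (pinv M * Y)) (Y - M * (pinv M * Y)) = 0 := by
        rw [frob_mul_left, hM.eq, h1]; simp [frob]
      rw [frob_comm, frob_sub_right, frob_comm _ Y, frob_comm _ (M * (pinv M * Y)),
        h2, h4, sub_zero]
    exact (sub_eq_zero.1 (frob_self_eq_zero h3)).symm
  · have h1 : (Y - Y * (pinv L * L)) * L = 0 := by
      rw [Matrix.sub_mul, pinv_mul_comm hL, Matrix.mul_assoc, (pinv_penrose hL).2.2.2, sub_self]
    have h2 := h (Y - Y * (pinv L * L)) (by rw [h1]; simp [frob])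
    have h3 : frob (Y - Y * (pinv L * L)) (Y - Y * (pinv L * L)) = 0 := by
      have h4 : frob (Y * (pinv L * L)) (Y - Y * (pinv L * L)) = 0 := by
        rw [frob_mul_right, (pinv_penrose hL).1, pinv_mul_comm hL, ← Matrix.mul_assoc,
          ← pinv_mul_comm hL, h1]
        simp [frob]
      rw [frob_comm, frob_sub_right, frob_comm _ Y, frob_comm _ (Y * _), h2, h4, sub_zero]
    exact (sub_eq_zero.1 (frob_self_eq_zero h3)).symm

/-- The effective domain of the support function `J_Λ`. -/
lemma suppO_lt_top {n k : ℕ} (Λ : Weights n k) {M : Matrix (Fin n) (Fin n) ℝ} (hM : M.IsSymm)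
    {Y : Matrix (Fin n) (Fin k) ℝ} {Z : Matrix (Fin n) (Fin n) ℝ} (h : suppO Λ M Y Z < ⊤) :
    M.PosSemidef ∧ M * (pinv M * Y) = Y ∧ Y * (pinv Λ.Λ₁ * Λ.Λ₁) = Y ∧ M * (pinv M * Z) = Z := by
  obtain ⟨c, hc⟩ : ∃ c : ℝ, ∀ p ∈ setO Λ,
      frob M (p.1 : Matrix (Fin n) (Fin n) ℝ) + frob Y p.2.1 + frob Z p.2.2 ≤ c := by
    refine ⟨(suppO Λ M Y Z).toReal, fun p hp => ?_⟩
    have h1 : ((frob M (p.1 : Matrix (Fin n) (Fin n) ℝ) + frob Y p.2.1 + frob Z p.2.2 : ℝ) : EReal)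
        ≤ suppO Λ M Y Z := le_iSup₂ (f := fun p (_ : p ∈ setO Λ) =>
          ((frob M (p.1 : Matrix (Fin n) (Fin n) ℝ) + frob Y p.2.1 + frob Z p.2.2 : ℝ) : EReal))
          p hp
    exact EReal.coe_le_coe_iff.1 (h1.trans (EReal.le_coe_toReal h.ne))
  have hY : ∀ B, frob (B * Λ.Λ₁) (M * (B * Λ.Λ₁)) = 0 → frob Y B = 0 := fun B hB =>
    eq_zero_of_forall_mul_le (c := c) fun s => by
      have := hc _ (topO_mem Λ (s • B) 0)
      rw [frob_topO Λ hM, Matrix.smul_mul, Matrix.mul_smul, frob_smul_left, frob_smul_right, hB,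
        frob_smul_right] at this
      simpa [frob] using this
  have hZ : ∀ B, frob (B * Λ.Λ₂) (M * (B * Λ.Λ₂)) = 0 → frob Z B = 0 := fun B hB =>
    eq_zero_of_forall_mul_le (c := c) fun s => by
      have := hc _ (topO_mem Λ 0 (s • B))
      rw [frob_topO Λ hM, Matrix.smul_mul, Matrix.mul_smul, frob_smul_left, frob_smul_right, hB,
        frob_smul_right] at this
      simpa [frob] using this
  have h1 := eq_of_forall_frob_eq_zero hM (psd_isSymm Λ.posSemidef) hY
  have h2 := eq_of_forall_frob_eq_zero hM (psd_isSymm Λ.posDef.posSemidef) hZ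
  refine ⟨?_, h1.1, h1.2, h2.1⟩
  rw [Matrix.posSemidef_iff_dotProduct_mulVec]
  refine ⟨by rw [Matrix.IsHermitian, Matrix.conjTranspose_eq_transpose_of_trivial]; exact hM,
    fun x => ?_⟩
  -- Scaling the negative semidefinite matrix `-x xᵀ` shows `xᵀ M x ≥ 0`.
  by_contra hx
  push Not at hx
  have hv : (Matrix.vecMulVec x x).PosSemidef := by
    simpa using Matrix.posSemidef_vecMulVec_self_star x
  have hxx : frob M (Matrix.vecMulVec x x) = star x ⬝ᵥ M *ᵥ x := by
    rw [frob, hM.eq, Matrix.mul_vecMulVec, Matrix.trace_vecMulVec, dotProduct_comm]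
    simp
  have hs : ∀ s : ℝ, 0 ≤ s → -s * (star x ⬝ᵥ M *ᵥ x) ≤ c := fun s hs => by
    have hm : ((⟨-(s • Matrix.vecMulVec x x), ((psd_isSymm hv).smul s).neg⟩, 0, 0) :
        symMat n × Matrix (Fin n) (Fin k) ℝ × Matrix (Fin n) (Fin n) ℝ) ∈ setO Λ := by
      simpa [setO] using hv.smul hs
    have := hc _ hm
    simp only [frob_neg_right, frob_smul_right, hxx] at this
    simpa [frob] using this
  have h3 := hs ((|c| + 1) / (-(star x ⬝ᵥ M *ᵥ x))) (by
    exact div_nonneg (by positivity) (by linarith))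
  rw [div_eq_mul_inv] at h3
  have h4 : -((|c| + 1) * (-(star x ⬝ᵥ M *ᵥ x))⁻¹) * (star x ⬝ᵥ M *ᵥ x) = |c| + 1 := by
    rw [inv_neg, mul_neg, neg_neg, inv_mul_cancel_right₀ hx.ne]
  rw [h4] at h3
  linarith [le_abs_self c]

/-- The quadratic form pairs a field of the form `(B Λ₁², C Λ₂²)` with `(u, W)` as `(B, C)` is
paired with `(M u Λ₁† Λ₁, M W)`. -/
lemma wForm_mul_sq {n k : ℕ} (Λ : Weights n k) {M : Matrix (Fin n) (Fin n) ℝ} (hM : M.IsSymm)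
    (B u : Matrix (Fin n) (Fin k) ℝ) (C W : Matrix (Fin n) (Fin n) ℝ) :
    wForm Λ M (B * Λ.Λ₁ ^ 2, C * Λ.Λ₂ ^ 2) (u, W) =
      frob B (M * u * (pinv Λ.Λ₁ * Λ.Λ₁)) + frob C (M * W) := by
  have e : ∀ {b : ℕ} {L : Matrix (Fin b) (Fin b) ℝ} (hL : L.IsSymm)
      (B u : Matrix (Fin n) (Fin b) ℝ), frob (B * L ^ 2 * pinv L) (M * (u * pinv L)) =
        frob B (M * u * (pinv L * L)) := fun {b L} hL B u => by
    have : B * L ^ 2 * pinv L = B * L := by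
      rw [sq, Matrix.mul_assoc, Matrix.mul_assoc, ← pinv_mul_comm hL, ← Matrix.mul_assoc L,
        (pinv_penrose hL).2.2.2]
    rw [this, frob_comm B, frob_mul_pinv_mul hM hL, frob_form_symm hM]
  rw [wForm_eq, e (psd_isSymm Λ.posSemidef), e (psd_isSymm Λ.posDef.posSemidef), Λ.pinv_Λ₂_mul,
    Matrix.mul_one]

lemma wForm_smul_middle {n k : ℕ} (Λ : Weights n k) (M : Matrix (Fin n) (Fin n) ℝ) (c : ℝ)
    (v w : Matrix (Fin n) (Fin k) ℝ × Matrix (Fin n) (Fin n) ℝ) :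
    wForm Λ (c • M) v w = c * wForm Λ M v w := by
  simp only [wForm, Matrix.smul_mul, frob_smul_right]
  ring

/-! ### Measurability of the Moore–Penrose inverse -/

lemma pinv_eq_of_isHermitian {n : ℕ} {A : Matrix (Fin n) (Fin n) ℝ} (hA : A.IsHermitian) :
    pinv A = (hA.eigenvectorUnitary : Matrix (Fin n) (Fin n) ℝ) *
      Matrix.diagonal (fun i => (hA.eigenvalues i)⁻¹) *
      (hA.eigenvectorUnitary : Matrix (Fin n) (Fin n) ℝ)ᵀ := by
  rw [pinv, dif_pos hA]

/-- Tikhonov regularization: `(A² + ε)⁻¹ A → A†` as `ε → 0`. -/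
lemma tendsto_tikhonov_pinv {n : ℕ} {A : Matrix (Fin n) (Fin n) ℝ} (hA : A.IsSymm) (i j : Fin n) :
    Filter.Tendsto (fun m : ℕ =>
      ((A * A + (1 / ((m : ℝ) + 1)) • (1 : Matrix (Fin n) (Fin n) ℝ))⁻¹ * A) i j) Filter.atTop
      (nhds (pinv A i j)) := by
  have hA' : A.IsHermitian := by
    rw [Matrix.IsHermitian, Matrix.conjTranspose_eq_transpose_of_trivial]; exact hA
  have hAeq := hA'.spectral_theorem
  rw [Unitary.conjStarAlgAut_apply, Matrix.star_eq_conjTranspose,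
    Matrix.conjTranspose_eq_transpose_of_trivial] at hAeq
  have hPP : (hA'.eigenvectorUnitary : Matrix (Fin n) (Fin n) ℝ)ᵀ *
      (hA'.eigenvectorUnitary : Matrix (Fin n) (Fin n) ℝ) = 1 := by
    have := Unitary.coe_star_mul_self hA'.eigenvectorUnitary
    rwa [Matrix.star_eq_conjTranspose, Matrix.conjTranspose_eq_transpose_of_trivial] at this
  rw [pinv_eq_of_isHermitian hA']
  have hAeq' : A = (hA'.eigenvectorUnitary : Matrix (Fin n) (Fin n) ℝ) *
      Matrix.diagonal hA'.eigenvalues * (hA'.eigenvectorUnitary : Matrix (Fin n) (Fin n) ℝ)ᵀ := hAeq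
  generalize hA'.eigenvalues = e at hAeq' ⊢
  generalize (hA'.eigenvectorUnitary : Matrix (Fin n) (Fin n) ℝ) = P at hAeq' hPP ⊢
  clear hAeq
  have hPP' : P * Pᵀ = 1 := mul_eq_one_comm.1 hPP
  have hmul : ∀ X Y : Matrix (Fin n) (Fin n) ℝ,
      P * X * Pᵀ * (P * Y * Pᵀ) = P * (X * Y) * Pᵀ := fun X Y => by
    calc P * X * Pᵀ * (P * Y * Pᵀ) = P * X * (Pᵀ * P) * (Y * Pᵀ) := by
          simp only [Matrix.mul_assoc]
      _ = P * (X * Y) * Pᵀ := by rw [hPP]; simp only [Matrix.mul_assoc, Matrix.one_mul]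
  have hreg : ∀ m : ℕ, (A * A + (1 / ((m : ℝ) + 1)) • (1 : Matrix (Fin n) (Fin n) ℝ))⁻¹ * A =
      P * Matrix.diagonal (fun i => (e i * e i + 1 / ((m : ℝ) + 1))⁻¹ * e i) * Pᵀ := fun m => by
    have hε : (0 : ℝ) < 1 / ((m : ℝ) + 1) := by positivity
    have h1 : A * A + (1 / ((m : ℝ) + 1)) • (1 : Matrix (Fin n) (Fin n) ℝ) =
        P * Matrix.diagonal (fun i => e i * e i + 1 / ((m : ℝ) + 1)) * Pᵀ := by
      have h2 : Matrix.diagonal (fun i => e i * e i + 1 / ((m : ℝ) + 1)) =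
          Matrix.diagonal e * Matrix.diagonal e + (1 / ((m : ℝ) + 1)) •
            (1 : Matrix (Fin n) (Fin n) ℝ) := by
        rw [Matrix.diagonal_mul_diagonal, Matrix.smul_one_eq_diagonal, Matrix.diagonal_add]
      rw [h2, Matrix.mul_add, Matrix.add_mul, ← hmul, ← hAeq', Matrix.mul_smul, Matrix.smul_mul,
        Matrix.mul_one, hPP']
    have h3 : (A * A + (1 / ((m : ℝ) + 1)) • (1 : Matrix (Fin n) (Fin n) ℝ))⁻¹ =
        P * Matrix.diagonal (fun i => (e i * e i + 1 / ((m : ℝ) + 1))⁻¹) * Pᵀ := by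
      refine Matrix.inv_eq_right_inv ?_
      rw [h1, hmul, Matrix.diagonal_mul_diagonal]
      have : (fun i => (e i * e i + 1 / ((m : ℝ) + 1)) * (e i * e i + 1 / ((m : ℝ) + 1))⁻¹) =
          fun _ => (1 : ℝ) := by
        funext i
        exact mul_inv_cancel₀ (by nlinarith [mul_self_nonneg (e i)])
      rw [this, Matrix.diagonal_one, Matrix.mul_one, hPP']
    rw [h3]
    conv_lhs => rw [hAeq']
    rw [hmul, Matrix.diagonal_mul_diagonal]
  simp only [hreg]
  have hcont : Continuous fun d : Fin n → ℝ => (P * Matrix.diagonal d * Pᵀ) i j :=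
    ((continuous_const.matrix_mul continuous_id.matrix_diagonal).matrix_mul
      continuous_const).matrix_elem i j
  refine (hcont.tendsto (fun i => (e i)⁻¹)).comp (tendsto_pi_nhds.2 fun l => ?_)
  have h0 : Filter.Tendsto (fun m : ℕ => e l * e l + 1 / ((m : ℝ) + 1)) Filter.atTop
      (nhds (e l * e l + 0)) := tendsto_one_div_add_atTop_nhds_zero_nat.const_add _
  by_cases hl : e l = 0
  · simp [hl]
  · have h4 := (h0.inv₀ (by simpa using hl)).mul_const (e l)
    rwa [add_zero, mul_inv, mul_assoc, inv_mul_cancel₀ hl, mul_one] at h4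

section Measures

variable {X : Type*} [MeasurableSpace X]

lemma measurable_mul_field {a b c : ℕ} {A : X → Matrix (Fin a) (Fin b) ℝ}
    {B : X → Matrix (Fin b) (Fin c) ℝ} (hA : ∀ i j, Measurable fun x => A x i j)
    (hB : ∀ i j, Measurable fun x => B x i j) (i : Fin a) (j : Fin c) :
    Measurable fun x => (A x * B x) i j := by
  simp only [Matrix.mul_apply]
  exact Finset.measurable_fun_sum _ fun l _ => (hA i l).mul (hB l j)

lemma measurable_inv_field {n : ℕ} {A : X → Matrix (Fin n) (Fin n) ℝ}
    (hA : ∀ i j, Measurable fun x => A x i j) (i j : Fin n) :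
    Measurable fun x => (A x)⁻¹ i j := by
  have hm : Measurable fun x => (fun i j => A x i j : Fin n → Fin n → ℝ) :=
    measurable_pi_lambda _ fun i => measurable_pi_lambda _ fun j => hA i j
  have hid : Continuous fun f : Fin n → Fin n → ℝ => (Matrix.of f : Matrix (Fin n) (Fin n) ℝ) :=
    continuous_id
  have h1 : Measurable fun x => (A x).det :=
    hid.matrix_det.measurable.comp hm
  have h2 : Measurable fun x => (A x).adjugate i j :=
    (hid.matrix_adjugate.matrix_elem i j).measurable.comp hm
  simp only [Matrix.inv_def, Ring.inverse_eq_inv', Matrix.smul_apply, smul_eq_mul]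
  exact h1.inv.mul h2

lemma measurable_pinv_field {n : ℕ} {A : X → Matrix (Fin n) (Fin n) ℝ}
    (hs : ∀ x, (A x).IsSymm) (hA : ∀ i j, Measurable fun x => A x i j) (i j : Fin n) :
    Measurable fun x => pinv (A x) i j := by
  refine measurable_of_tendsto_metrizable (f := fun (m : ℕ) x =>
    ((A x * A x + (1 / ((m : ℝ) + 1)) • (1 : Matrix (Fin n) (Fin n) ℝ))⁻¹ * A x) i j) (fun m => ?_)
    (tendsto_pi_nhds.2 fun x => tendsto_tikhonov_pinv (hs x) i j)
  refine measurable_mul_field (measurable_inv_field fun i j => ?_) hA i j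
  simp only [Matrix.add_apply]
  exact (measurable_mul_field hA hA i j).add measurable_const

/-! ### Densities of matrix-valued measures -/

lemma measurable_dens {a b : ℕ} (μ : VectorMeasure X (Matrix (Fin a) (Fin b) ℝ)) (ν : Measure X)
    (i : Fin a) (j : Fin b) : Measurable fun x => dens μ ν x i j :=
  SignedMeasure.measurable_rnDeriv _ _

lemma integrable_dens {a b : ℕ} (μ : VectorMeasure X (Matrix (Fin a) (Fin b) ℝ)) (ν : Measure X)
    (i : Fin a) (j : Fin b) : Integrable (fun x => dens μ ν x i j) ν :=
  SignedMeasure.integrable_rnDeriv _ _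

lemma dens_toMat_isSymm {n : ℕ} (G : VectorMeasure X (symMat n)) (ν : Measure X) (x : X) :
    (dens (toMat G) ν x).IsSymm := by
  have h : ∀ i j, entry (toMat G) i j = entry (toMat G) j i := fun i j => by
    ext s _
    exact ((G s).2.apply j i)
  ext i j
  simp only [dens, Matrix.transpose_apply, Matrix.of_apply, h i j]

lemma totalVariation_entry_le {a b : ℕ} (μ : VectorMeasure X (Matrix (Fin a) (Fin b) ℝ))
    (i : Fin a) (j : Fin b) : (entry μ i j).totalVariation ≤ refMeasure μ := by
  refine le_trans ?_ (Finset.single_le_sum (f := fun i => ∑ j, (entry μ i j).totalVariation)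
    (fun _ _ => Measure.zero_le _) (Finset.mem_univ i))
  exact Finset.single_le_sum (f := fun j => (entry μ i j).totalVariation)
    (fun _ _ => Measure.zero_le _) (Finset.mem_univ j)

lemma totalVariation_entry_ac {a b : ℕ} {μ : VectorMeasure X (Matrix (Fin a) (Fin b) ℝ)}
    {ν : Measure X} (h : refMeasure μ ≪ ν) (i : Fin a) (j : Fin b) :
    (entry μ i j).totalVariation ≪ ν :=
  (Measure.absolutelyContinuous_of_le (totalVariation_entry_le μ i j)).trans h

lemma ennrealToMeasure_toENNRealVectorMeasure (ν : Measure X) :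
    ν.toENNRealVectorMeasure.ennrealToMeasure = ν :=
  VectorMeasure.equivMeasure.right_inv ν

lemma withDensity_rnDeriv_of_totalVariation_ac {s : SignedMeasure X} {ν : Measure X}
    [IsFiniteMeasure ν] (h : s.totalVariation ≪ ν) : ν.withDensityᵥ (s.rnDeriv ν) = s := by
  refine SignedMeasure.withDensityᵥ_rnDeriv_eq s ν ?_
  rw [SignedMeasure.absolutelyContinuous_ennreal_iff, ennrealToMeasure_toENNRealVectorMeasure]
  exact h

lemma integral_signedMeasure_eq {s : SignedMeasure X} {ν : Measure X} [IsFiniteMeasure ν]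
    (h : s.totalVariation ≪ ν) {f : X → ℝ} (hf : Measurable f) {C : ℝ} (hC : ∀ x, ‖f x‖ ≤ C) :
    ∫ᵛ x, f x ∂<•s = ∫ x, s.rnDeriv ν x * f x ∂ν := by
  have hac := (SignedMeasure.totalVariation_absolutelyContinuous_iff s ν).1 h
  have hint : ∀ (ρ : Measure X) [IsFiniteMeasure ρ], Integrable f ρ := fun ρ _ =>
    Integrable.of_bound hf.aestronglyMeasurable C (Filter.Eventually.of_forall hC)
  have hv : ∀ (ρ : Measure X) [IsFiniteMeasure ρ], ρ.toSignedMeasure.Integrable f := fun ρ _ => by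
    simpa [VectorMeasure.Integrable] using hint ρ
  conv_lhs => rw [← s.toSignedMeasure_toJordanDecomposition, JordanDecomposition.toSignedMeasure]
  rw [VectorMeasure.integral_sub_vectorMeasure (hv _) (hv _),
    VectorMeasure.integral_toSignedMeasure, VectorMeasure.integral_toSignedMeasure,
    ← integral_rnDeriv_smul hac.1, ← integral_rnDeriv_smul hac.2, ← integral_sub]
  · simp only [SignedMeasure.rnDeriv, smul_eq_mul, sub_mul]
  · exact (integrable_rnDeriv_smul_iff hac.1).2 (hint _)
  · exact (integrable_rnDeriv_smul_iff hac.2).2 (hint _)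

lemma integrable_dens_mul {a b : ℕ} (μ : VectorMeasure X (Matrix (Fin a) (Fin b) ℝ))
    (ν : Measure X) {f : X → ℝ} (hf : Measurable f) {C : ℝ} (hC : ∀ x, ‖f x‖ ≤ C)
    (i : Fin a) (j : Fin b) : Integrable (fun x => dens μ ν x i j * f x) ν := by
  simp only [mul_comm _ (f _)]
  exact (integrable_dens μ ν i j).bdd_mul hf.aestronglyMeasurable (Filter.Eventually.of_forall hC)

lemma integrable_frob_dens {a b : ℕ} (μ : VectorMeasure X (Matrix (Fin a) (Fin b) ℝ))
    (ν : Measure X) {f : X → Matrix (Fin a) (Fin b) ℝ} (hf : ∀ i j, Measurable fun x => f x i j)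
    {C : ℝ} (hC : ∀ i j x, ‖f x i j‖ ≤ C) : Integrable (fun x => frob (dens μ ν x) (f x)) ν := by
  simp only [frob_eq_sum]
  exact integrable_finsetSum _ fun j _ => integrable_finsetSum _ fun i _ =>
    integrable_dens_mul μ ν (hf i j) (hC i j) i j

/-- The pairing of a matrix-valued measure with a bounded field, through densities. -/
lemma pairing_eq_integral {a b : ℕ} {μ : VectorMeasure X (Matrix (Fin a) (Fin b) ℝ)}
    {ν : Measure X} [IsFiniteMeasure ν] (h : refMeasure μ ≪ ν) {f : X → Matrix (Fin a) (Fin b) ℝ}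
    (hf : ∀ i j, Measurable fun x => f x i j) {C : ℝ} (hC : ∀ i j x, ‖f x i j‖ ≤ C) :
    pairing μ f = ∫ x, frob (dens μ ν x) (f x) ∂ν := by
  simp only [frob_eq_sum]
  rw [integral_finsetSum _ fun j _ => integrable_finsetSum _ fun i _ =>
    integrable_dens_mul μ ν (hf i j) (hC i j) i j, pairing, Finset.sum_comm]
  refine Finset.sum_congr rfl fun j _ => ?_
  rw [integral_finsetSum _ fun i _ => integrable_dens_mul μ ν (hf i j) (hC i j) i j]
  exact Finset.sum_congr rfl fun i _ =>
    integral_signedMeasure_eq (totalVariation_entry_ac h i j) (hf i j) (hC i j)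

lemma rnDeriv_eq_of_withDensity {s : SignedMeasure X} {γ ν : Measure X} [IsFiniteMeasure γ]
    [IsFiniteMeasure ν] (hγ : γ ≪ ν) {g : X → ℝ} (hg : Integrable g γ) (hs : γ.withDensityᵥ g = s) :
    s.rnDeriv ν =ᵐ[ν] fun x => (γ.rnDeriv ν x).toReal * g x := by
  have h1 := withDensityᵥ_rnDeriv_smul hγ hg
  rw [hs] at h1
  have hsν : ν.withDensityᵥ (s.rnDeriv ν) = s := by
    refine SignedMeasure.withDensityᵥ_rnDeriv_eq s ν ?_
    rw [← h1]
    exact Measure.withDensityᵥ_absolutelyContinuous _ _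
  refine (SignedMeasure.integrable_rnDeriv _ _).ae_eq_of_withDensityᵥ_eq
    ((integrable_rnDeriv_smul_iff hγ).2 hg) ?_
  rw [hsν]
  exact h1.symm

lemma dens_ae_eq_smul_of_withDensity {a b : ℕ} {μ : VectorMeasure X (Matrix (Fin a) (Fin b) ℝ)}
    {γ ν : Measure X} [IsFiniteMeasure γ] [IsFiniteMeasure ν] (hγ : γ ≪ ν)
    {F : X → Matrix (Fin a) (Fin b) ℝ} (hF : ∀ i j, Integrable (fun x => F x i j) γ)
    (h : ∀ i j, γ.withDensityᵥ (fun x => F x i j) = entry μ i j) :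
    ∀ᵐ x ∂ν, dens μ ν x = (γ.rnDeriv ν x).toReal • F x := by
  have : ∀ᵐ x ∂ν, ∀ i j, (entry μ i j).rnDeriv ν x = (γ.rnDeriv ν x).toReal * F x i j :=
    ae_all_iff.2 fun i => ae_all_iff.2 fun j => rnDeriv_eq_of_withDensity hγ (hF i j) (h i j)
  filter_upwards [this] with x hx
  ext i j
  simp [dens, hx]

lemma dens_ae_eq_smul_dens {a b : ℕ} {μ : VectorMeasure X (Matrix (Fin a) (Fin b) ℝ)}
    {γ ν : Measure X} [IsFiniteMeasure γ] [IsFiniteMeasure ν] (hμ : refMeasure μ ≪ γ)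
    (hγ : γ ≪ ν) : ∀ᵐ x ∂ν, dens μ ν x = (γ.rnDeriv ν x).toReal • dens μ γ x :=
  dens_ae_eq_smul_of_withDensity hγ (integrable_dens μ γ) fun i j =>
    withDensity_rnDeriv_of_totalVariation_ac (totalVariation_entry_ac hμ i j)

/-- The matrix-valued measure `F γ` with density `F`, entry by entry. -/
noncomputable def ofDensity {a b : ℕ} (γ : Measure X) (F : X → Matrix (Fin a) (Fin b) ℝ) :
    VectorMeasure X (Matrix (Fin a) (Fin b) ℝ) where
  measureOf' s := Matrix.of fun i j => γ.withDensityᵥ (fun x => F x i j) s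
  empty' := by ext i j; simp
  not_measurable' s hs := by
    ext i j
    simp [VectorMeasure.not_measurable _ hs]
  m_iUnion' f hf hd := by
    refine Pi.hasSum.2 fun i => Pi.hasSum.2 fun j => ?_
    exact (γ.withDensityᵥ (fun x => F x i j)).m_iUnion hf hd

lemma entry_ofDensity {a b : ℕ} (γ : Measure X) (F : X → Matrix (Fin a) (Fin b) ℝ) (i : Fin a)
    (j : Fin b) : γ.withDensityᵥ (fun x => F x i j) = entry (ofDensity γ F) i j := by
  ext s _
  rfl

end Measures

/-! ### Fields representing momentum measures -/

section Measures

variable {X : Type*} [MeasurableSpace X] {n k : ℕ}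

lemma refMeasure_toMat_ac (G : VectorMeasure X (symMat n))
    (q : VectorMeasure X (Matrix (Fin n) (Fin k) ℝ))
    (R : VectorMeasure X (Matrix (Fin n) (Fin n) ℝ)) :
    refMeasure (toMat G) ≪ refTriple G q R :=
  (Measure.AbsolutelyContinuous.refl _).add_right _ |>.add_right _

lemma refMeasure_fst_ac (G : VectorMeasure X (symMat n))
    (q : VectorMeasure X (Matrix (Fin n) (Fin k) ℝ))
    (R : VectorMeasure X (Matrix (Fin n) (Fin n) ℝ)) : refMeasure q ≪ refTriple G q R := by
  refine Measure.absolutelyContinuous_of_le ?_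
  rw [refTriple, add_comm (refMeasure (toMat G)), add_assoc]
  exact Measure.le_add_right le_rfl

lemma refMeasure_snd_ac (G : VectorMeasure X (symMat n))
    (q : VectorMeasure X (Matrix (Fin n) (Fin k) ℝ))
    (R : VectorMeasure X (Matrix (Fin n) (Fin n) ℝ)) : refMeasure R ≪ refTriple G q R :=
  Measure.absolutelyContinuous_of_le (Measure.le_add_left le_rfl)

instance (G : VectorMeasure X (symMat n)) (q : VectorMeasure X (Matrix (Fin n) (Fin k) ℝ))
    (R : VectorMeasure X (Matrix (Fin n) (Fin n) ℝ)) : IsFiniteMeasure (refTriple G q R) := by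
  unfold refTriple; infer_instance

/-- If the density of `G` with respect to some dominating measure is positive semidefinite almost
everywhere, so is the density with respect to the reference measure of `G`. -/
lemma psdDens_ae_eq_dens {G : VectorMeasure X (symMat n)} {ν : Measure X} [IsFiniteMeasure ν]
    (hν : refMeasure (toMat G) ≪ ν) (h : ∀ᵐ x ∂ν, (dens (toMat G) ν x).PosSemidef) :
    ∀ᵐ x ∂refMeasure (toMat G), psdDens G x = dens (toMat G) (refMeasure (toMat G)) x := by
  filter_upwards [hν.ae_le h, hν.ae_le (dens_ae_eq_smul_dens (μ := toMat G)
    Measure.AbsolutelyContinuous.rfl hν), Measure.rnDeriv_pos hν,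
    hν.ae_le (Measure.rnDeriv_lt_top (refMeasure (toMat G)) ν)] with x h1 h2 h3 h4
  have ht : 0 < ((refMeasure (toMat G)).rnDeriv ν x).toReal := ENNReal.toReal_pos h3.ne' h4.ne
  have h5 : dens (toMat G) (refMeasure (toMat G)) x =
      ((refMeasure (toMat G)).rnDeriv ν x).toReal⁻¹ • dens (toMat G) ν x := by
    rw [h2, smul_smul, inv_mul_cancel₀ ht.ne', one_smul]
  rw [psdDens, if_pos]
  rw [h5]
  exact h1.smul (inv_nonneg.2 ht.le)

lemma dens_ae_eq_smul_psdDens {G : VectorMeasure X (symMat n)} {ν : Measure X}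
    [IsFiniteMeasure ν] (hν : refMeasure (toMat G) ≪ ν)
    (h : ∀ᵐ x ∂refMeasure (toMat G), psdDens G x = dens (toMat G) (refMeasure (toMat G)) x) :
    ∀ᵐ x ∂ν, dens (toMat G) ν x =
      ((refMeasure (toMat G)).rnDeriv ν x).toReal • psdDens G x := by
  have h' := h
  rw [← Measure.withDensity_rnDeriv_eq _ _ hν,
    ae_withDensity_iff (Measure.measurable_rnDeriv _ _)] at h'
  rw [Measure.withDensity_rnDeriv_eq _ _ hν] at h'
  filter_upwards [h', dens_ae_eq_smul_dens (μ := toMat G) Measure.AbsolutelyContinuous.rfl hν]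
    with x h1 h2
  by_cases ht : (refMeasure (toMat G)).rnDeriv ν x = 0
  · rw [h2, ht, ENNReal.toReal_zero, zero_smul, zero_smul]
  · rw [h2, h1 ht]

/-- The field `v = (u, W)` represents the pair `(q, R)` relative to `G`: in terms of densities, `G`
is positive semidefinite, `q = G u Λ₁† Λ₁` and `R = G W`. -/
def Represents (Λ : Weights n k) (G : VectorMeasure X (symMat n))
    (q : VectorMeasure X (Matrix (Fin n) (Fin k) ℝ))
    (R : VectorMeasure X (Matrix (Fin n) (Fin n) ℝ))
    (v : X → Matrix (Fin n) (Fin k) ℝ × Matrix (Fin n) (Fin n) ℝ) : Prop :=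
  ∀ᵐ x ∂refTriple G q R, (dens (toMat G) (refTriple G q R) x).PosSemidef ∧
    dens q (refTriple G q R) x =
      dens (toMat G) (refTriple G q R) x * (v x).1 * (pinv Λ.Λ₁ * Λ.Λ₁) ∧
    dens R (refTriple G q R) x = dens (toMat G) (refTriple G q R) x * (v x).2

variable {Λ : Weights n k} {G : VectorMeasure X (symMat n)}
  {q : VectorMeasure X (Matrix (Fin n) (Fin k) ℝ)} {R : VectorMeasure X (Matrix (Fin n) (Fin n) ℝ)}
  {v : X → Matrix (Fin n) (Fin k) ℝ × Matrix (Fin n) (Fin n) ℝ}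

lemma Represents.psdDens_ae_eq (h : Represents Λ G q R v) :
    ∀ᵐ x ∂refMeasure (toMat G), psdDens G x = dens (toMat G) (refMeasure (toMat G)) x :=
  psdDens_ae_eq_dens (refMeasure_toMat_ac G q R) (h.mono fun _ hx => hx.1)

lemma Represents.dens_ae_eq (h : Represents Λ G q R v) :
    ∀ᵐ x ∂refTriple G q R, dens (toMat G) (refTriple G q R) x =
      ((refMeasure (toMat G)).rnDeriv (refTriple G q R) x).toReal • psdDens G x :=
  dens_ae_eq_smul_psdDens (refMeasure_toMat_ac G q R) h.psdDens_ae_eq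

/-- A representing field computes the action. -/
lemma Represents.action_eq (h : Represents Λ G q R v) :
    action Λ G q R = 1 / 2 * sqNorm Λ G v := by
  have hν := refMeasure_toMat_ac G q R
  have h1 : sqNorm Λ G v = ∫⁻ x, (refMeasure (toMat G)).rnDeriv (refTriple G q R) x *
      ENNReal.ofReal (wForm Λ (psdDens G x) (v x) (v x)) ∂(refTriple G q R) := by
    have h2 := lintegral_withDensity_eq_lintegral_mul_non_measurable (refTriple G q R)
      (Measure.measurable_rnDeriv (refMeasure (toMat G)) (refTriple G q R))
      (Measure.rnDeriv_lt_top _ _) fun x => ENNReal.ofReal (wForm Λ (psdDens G x) (v x) (v x))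
    rw [Measure.withDensity_rnDeriv_eq _ _ hν] at h2
    exact h2
  rw [h1, ← lintegral_const_mul' _ _ (by simp), action]
  refine lintegral_congr_ae ?_
  filter_upwards [h, h.dens_ae_eq, Measure.rnDeriv_lt_top (refMeasure (toMat G))
    (refTriple G q R)] with x hx h2 h3
  rw [hx.2.1, hx.2.2, suppO_eq_half_wForm Λ hx.1, EReal.real_coe_toENNReal, h2, wForm_smul_middle,
    ENNReal.ofReal_mul (by norm_num), ENNReal.ofReal_mul ENNReal.toReal_nonneg,
    ENNReal.ofReal_toReal h3.ne]
  simp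

/-- `J_Λ` is lower semicontinuous, being a supremum of linear functions. -/
lemma lowerSemicontinuous_suppO (Λ : Weights n k) :
    LowerSemicontinuous fun p : (Fin n → Fin n → ℝ) × (Fin n → Fin k → ℝ) ×
      (Fin n → Fin n → ℝ) => suppO Λ (Matrix.of p.1) (Matrix.of p.2.1) (Matrix.of p.2.2) := by
  refine lowerSemicontinuous_biSup fun A _ => Continuous.lowerSemicontinuous ?_
  refine continuous_coe_real_ereal.comp ?_
  simp only [frob_eq_sum, Matrix.of_apply]
  refine Continuous.add (Continuous.add ?_ ?_) ?_
  · exact continuous_finsetSum _ fun j _ => continuous_finsetSum _ fun i _ => 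
      Continuous.mul (by fun_prop) continuous_const
  · exact continuous_finsetSum _ fun j _ => continuous_finsetSum _ fun i _ => 
      Continuous.mul (by fun_prop) continuous_const
  · exact continuous_finsetSum _ fun j _ => continuous_finsetSum _ fun i _ => 
      Continuous.mul (by fun_prop) continuous_const
lemma measurable_suppO_dens (Λ : Weights n k) (G : VectorMeasure X (symMat n))
    (q : VectorMeasure X (Matrix (Fin n) (Fin k) ℝ))
    (R : VectorMeasure X (Matrix (Fin n) (Fin n) ℝ))
    (ν : Measure X) :
    Measurable fun x => suppO Λ (dens (toMat G) ν x) (dens q ν x) (dens R ν x) := by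
  have h1 : Measurable fun x => (fun i j => dens (toMat G) ν x i j : Fin n → Fin n → ℝ) :=
    measurable_pi_lambda _ fun i => measurable_pi_lambda _ fun j => measurable_dens _ _ i j
  have h2 : Measurable fun x => (fun i j => dens q ν x i j : Fin n → Fin k → ℝ) :=
    measurable_pi_lambda _ fun i => measurable_pi_lambda _ fun j => measurable_dens _ _ i j
  have h3 : Measurable fun x => (fun i j => dens R ν x i j : Fin n → Fin n → ℝ) :=
    measurable_pi_lambda _ fun i => measurable_pi_lambda _ fun j => measurable_dens _ _ i j
  have hm := h1.prodMk (h2.prodMk h3)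
  have e : ∀ {b : ℕ} (A : Matrix (Fin n) (Fin b) ℝ), Matrix.of (fun i j => A i j) = A :=
    fun A => rfl
  have h := (lowerSemicontinuous_suppO Λ).measurable.comp hm
  simp only [Function.comp_def, e] at h
  exact h

/-- Finite action forces `(q, R)` to be represented by the field `(G† q, G† R)`. -/
lemma represents_of_action_lt_top (h : action Λ G q R < ⊤) :
    Represents Λ G q R fun x =>
      (pinv (dens (toMat G) (refTriple G q R) x) * dens q (refTriple G q R) x,
        pinv (dens (toMat G) (refTriple G q R) x) * dens R (refTriple G q R) x) := by
  have h1 := ae_lt_top (measurable_suppO_dens Λ G q R (refTriple G q R)).ereal_toENNReal h.ne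
  filter_upwards [h1] with x hx
  have hx' : suppO Λ (dens (toMat G) (refTriple G q R) x) (dens q (refTriple G q R) x)
      (dens R (refTriple G q R) x) < ⊤ := by
    rw [lt_top_iff_ne_top] at hx ⊢
    exact fun h0 => hx (by rw [h0, EReal.toENNReal_top])
  obtain ⟨hp, h2, h3, h4⟩ := suppO_lt_top Λ (dens_toMat_isSymm _ _ _) hx'
  exact ⟨hp, by simp only [h2, h3], h4.symm⟩

lemma measField_pinv_dens (G : VectorMeasure X (symMat n))
    (q : VectorMeasure X (Matrix (Fin n) (Fin k) ℝ))
    (R : VectorMeasure X (Matrix (Fin n) (Fin n) ℝ)) (ν : Measure X) :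
    MeasField fun x => (pinv (dens (toMat G) ν x) * dens q ν x,
      pinv (dens (toMat G) ν x) * dens R ν x) := by
  have hp := measurable_pinv_field (dens_toMat_isSymm G ν) (measurable_dens _ _)
  exact ⟨measurable_mul_field hp (measurable_dens _ _),
    measurable_mul_field hp (measurable_dens _ _)⟩

/-- Testing `(q, R)` against `(B, C)` is taking the inner product of a representing field with
`(B Λ₁², C Λ₂²)`. -/
lemma Represents.integral_wForm_eq (h : Represents Λ G q R v)
    {B : X → Matrix (Fin n) (Fin k) ℝ} {C : X → Matrix (Fin n) (Fin n) ℝ}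
    (hB : ∀ i j, Measurable fun x => B x i j) (hC : ∀ i j, Measurable fun x => C x i j)
    {K : ℝ} (hBK : ∀ i j x, ‖B x i j‖ ≤ K) (hCK : ∀ i j x, ‖C x i j‖ ≤ K) :
    ∫ x, wForm Λ (psdDens G x) (B x * Λ.Λ₁ ^ 2, C x * Λ.Λ₂ ^ 2) (v x) ∂(refMeasure (toMat G)) =
      pairing q B + pairing R C := by
  rw [pairing_eq_integral (refMeasure_fst_ac G q R) hB hBK,
    pairing_eq_integral (refMeasure_snd_ac G q R) hC hCK,
    ← integral_add (integrable_frob_dens _ _ hB hBK) (integrable_frob_dens _ _ hC hCK),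
    ← integral_rnDeriv_smul (refMeasure_toMat_ac G q R)]
  refine integral_congr_ae ?_
  filter_upwards [h, h.dens_ae_eq] with x hx h2
  rw [smul_eq_mul, ← wForm_smul_middle, ← h2, wForm_mul_sq Λ (dens_toMat_isSymm _ _ _), ← hx.2.1,
    ← hx.2.2, frob_comm (B x), frob_comm (C x)]

/-- For a field `a` with integrable quadratic form, the matrix field `G a` is integrable. -/
lemma integrable_psdDens_mul {b : ℕ} {a : X → Matrix (Fin n) (Fin b) ℝ}
    (ha : ∀ i j, Measurable fun x => a x i j) {f : X → ℝ}
    (hf : Integrable f (refMeasure (toMat G)))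
    (hle : ∀ x, frob (a x) (psdDens G x * a x) ≤ f x) (L : Matrix (Fin b) (Fin b) ℝ) (i : Fin n)
    (j : Fin b) :
    Integrable (fun x => (psdDens G x * a x * L) i j) (refMeasure (toMat G)) := by
  have e : ∀ x, (psdDens G x * a x * L) i j = ∑ l, (psdDens G x * a x) i l * L l j :=
    fun x => Matrix.mul_apply
  simp only [e]
  refine integrable_finsetSum _ fun l _ => Integrable.mul_const ?_ _
  refine ((integrable_psdDens G i i).add hf).mono'
    (measurable_mul_field (measurable_psdDens G) ha i l).aestronglyMeasurable
    (Filter.Eventually.of_forall fun x => ?_)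
  have hM := psdDens_posSemidef G x
  have h1 := sq_mul_apply_le hM (a x) i l
  have h2 := psd_diag_nonneg hM i
  have h3 := (frob_form_nonneg hM (a x)).trans (hle x)
  have h4 := mul_le_mul_of_nonneg_left (hle x) h2
  rw [Real.norm_eq_abs, Pi.add_apply]
  exact abs_le_of_sq_le_sq (by nlinarith) (by linarith)

/-- Every field of finite seminorm represents a pair of measures. -/
lemma exists_represents
    (hG : ∀ᵐ x ∂refMeasure (toMat G), psdDens G x = dens (toMat G) (refMeasure (toMat G)) x)
    (hv : v ∈ fieldSpace Λ G) :
    ∃ (q : VectorMeasure X (Matrix (Fin n) (Fin k) ℝ))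
      (R : VectorMeasure X (Matrix (Fin n) (Fin n) ℝ)), Represents Λ G q R v := by
  have hi := integrable_wForm hv hv
  have h1 : ∀ i j, Integrable (fun x => (psdDens G x * (v x).1 * (pinv Λ.Λ₁ * Λ.Λ₁)) i j)
      (refMeasure (toMat G)) := fun i j => by
    have e : ∀ x, psdDens G x * (v x).1 * (pinv Λ.Λ₁ * Λ.Λ₁) =
        psdDens G x * ((v x).1 * pinv Λ.Λ₁) * Λ.Λ₁ := fun x => by simp only [Matrix.mul_assoc]
    simp only [e]
    refine integrable_psdDens_mul (measurable_mul_const hv.1.1 _) hi (fun x => ?_) _ i j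
    rw [wForm]
    exact le_add_of_nonneg_right (frob_form_nonneg (psdDens_posSemidef G x) _)
  have h2 : ∀ i j, Integrable (fun x => (psdDens G x * (v x).2) i j)
      (refMeasure (toMat G)) := fun i j => by
    have e : ∀ x, psdDens G x * (v x).2 = psdDens G x * ((v x).2 * pinv Λ.Λ₂) * Λ.Λ₂ := fun x => by
      rw [Matrix.mul_assoc, Matrix.mul_assoc, Λ.pinv_Λ₂_mul, Matrix.mul_one]
    simp only [e]
    refine integrable_psdDens_mul (measurable_mul_const hv.1.2 _) hi (fun x => ?_) _ i j
    rw [wForm_eq]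
    exact le_add_of_nonneg_left (frob_form_nonneg (psdDens_posSemidef G x) _)
  refine ⟨ofDensity (refMeasure (toMat G)) fun x => psdDens G x * (v x).1 * (pinv Λ.Λ₁ * Λ.Λ₁),
    ofDensity (refMeasure (toMat G)) fun x => psdDens G x * (v x).2, ?_⟩
  have hac := refMeasure_toMat_ac G
    (ofDensity (refMeasure (toMat G)) fun x => psdDens G x * (v x).1 * (pinv Λ.Λ₁ * Λ.Λ₁))
    (ofDensity (refMeasure (toMat G)) fun x => psdDens G x * (v x).2)
  filter_upwards [dens_ae_eq_smul_psdDens hac hG,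
    dens_ae_eq_smul_of_withDensity hac h1 (entry_ofDensity _ _),
    dens_ae_eq_smul_of_withDensity hac h2 (entry_ofDensity _ _)] with x e1 e2 e3
  rw [e1, e2, e3]
  refine ⟨(psdDens_posSemidef G x).smul ENNReal.toReal_nonneg, ?_, ?_⟩
  · simp only [Matrix.smul_mul]
  · simp only [Matrix.smul_mul]

end Measures

/-! ### Completeness of `L²_{G,Λ}` -/

/-- The quadratic form of `M` at `A` is a function of `M A`, namely the quadratic form of `M†`. -/
lemma frob_form_eq_pinv {a b : ℕ} {M : Matrix (Fin a) (Fin a) ℝ} (hM : M.IsSymm)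
    (A : Matrix (Fin a) (Fin b) ℝ) :
    frob A (M * A) = frob (M * A) (pinv M * (M * A)) := by
  rw [frob_mul_left, hM.eq, ← Matrix.mul_assoc, ← Matrix.mul_assoc, (pinv_penrose hM).2.2.2]

/-- If `M uₘ L†` converges to `F`, then `M† F L` is the limit of `uₘ` for the seminorm given by the
form `M`. -/
lemma tendsto_frob_form {n b : ℕ} {M : Matrix (Fin n) (Fin n) ℝ} (hM : M.IsSymm)
    {L : Matrix (Fin b) (Fin b) ℝ} (hL : L.IsSymm) {u : ℕ → Matrix (Fin n) (Fin b) ℝ}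
    {F : Matrix (Fin n) (Fin b) ℝ}
    (h : ∀ i j, Filter.Tendsto (fun m => (M * (u m * pinv L)) i j) Filter.atTop (nhds (F i j)))
    (w : Matrix (Fin n) (Fin b) ℝ) :
    Filter.Tendsto (fun m => frob ((w - u m) * pinv L) (M * ((w - u m) * pinv L))) Filter.atTop
      (nhds (frob ((w - pinv M * F * L) * pinv L) (M * ((w - pinv M * F * L) * pinv L)))) := by
  have hF : Filter.Tendsto (fun m => M * (u m * pinv L)) Filter.atTop (nhds F) :=
    tendsto_pi_nhds.2 fun i => tendsto_pi_nhds.2 fun j => h i j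
  have hfix : M * (pinv M * F * L * pinv L) = F := by
    have hc : Continuous fun A : Matrix (Fin n) (Fin b) ℝ => M * (pinv M * A * L * pinv L) :=
      continuous_const.matrix_mul (((continuous_const.matrix_mul continuous_id).matrix_mul
        continuous_const).matrix_mul continuous_const)
    refine tendsto_nhds_unique ((hc.tendsto F).comp hF) ?_
    convert hF using 2 with m
    calc M * (pinv M * (M * (u m * pinv L)) * L * pinv L)
        = (M * pinv M * M) * u m * (pinv L * L * pinv L) := by simp only [Matrix.mul_assoc]
      _ = M * (u m * pinv L) := by
        rw [(pinv_penrose hM).2.2.2, (pinv_penrose hL).2.2.1, Matrix.mul_assoc]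
  have hc : Continuous fun A : Matrix (Fin n) (Fin b) ℝ => frob A (pinv M * A) := by
    have : Continuous fun A : Matrix (Fin n) (Fin b) ℝ => (Aᵀ * (pinv M * A)).trace :=
      (continuous_id.matrix_transpose.matrix_mul
        (continuous_const.matrix_mul continuous_id)).matrix_trace
    exact this
  simp only [frob_form_eq_pinv hM ((_ - _) * _)]
  refine (hc.tendsto _).comp ?_
  have e : ∀ v, M * ((w - v) * pinv L) = M * (w * pinv L) - M * (v * pinv L) := fun v => by
    rw [Matrix.sub_mul, Matrix.mul_sub]
  simp only [e, hfix]
  exact tendsto_const_nhds.sub hF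

section Measures

variable {X : Type*} [MeasurableSpace X] {n k : ℕ}

/-- For a rapidly Cauchy sequence of fields `a` the images `G a` converge almost everywhere. -/
lemma exists_limit_psdDens_mul (G : VectorMeasure X (symMat n)) {b : ℕ}
    {a : ℕ → X → Matrix (Fin n) (Fin b) ℝ} (ha : ∀ m i j, Measurable fun x => a m x i j)
    (h : ∀ N m l, N ≤ m → N ≤ l →
      ∫⁻ x, ENNReal.ofReal (frob (a m x - a l x) (psdDens G x * (a m x - a l x)))
        ∂(refMeasure (toMat G)) < ((2⁻¹ : ℝ≥0∞) ^ N) ^ 2) :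
    ∃ F : X → Matrix (Fin n) (Fin b) ℝ, (∀ i j, Measurable fun x => F x i j) ∧
      ∀ᵐ x ∂(refMeasure (toMat G)), ∀ i j,
        Filter.Tendsto (fun m => (psdDens G x * a m x) i j) Filter.atTop (nhds (F x i j)) := by
  have key : ∀ i j, ∃ f : X → ℝ, Measurable f ∧ ∀ᵐ x ∂(refMeasure (toMat G)),
      Filter.Tendsto (fun m => (psdDens G x * a m x) i j) Filter.atTop (nhds (f x)) := by
    intro i j
    have hmeas : ∀ m, Measurable fun x => (psdDens G x * a m x) i j := fun m =>
      measurable_mul_field (measurable_psdDens G) (ha m) i j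
    -- Dividing by `√(1 + Gᵢᵢ)` makes the entry square integrable.
    set s : X → ℝ := fun x => √(1 + psdDens G x i i) with hs
    have hspos : ∀ x, 0 < s x := fun x =>
      Real.sqrt_pos.2 (by linarith [psd_diag_nonneg (psdDens_posSemidef G x) i])
    have hsm : Measurable s := ((measurable_psdDens G i i).const_add 1).sqrt
    refine measurable_limit_of_tendsto_metrizable_ae (fun m => (hmeas m).aemeasurable) ?_
    have hB : ∑' N : ℕ, (2⁻¹ : ℝ≥0∞) ^ N ≠ ⊤ := by
      rw [ENNReal.tsum_geometric]
      simp
    have hlim := Lp.ae_tendsto_of_cauchy_eLpNorm (p := 2) (μ := refMeasure (toMat G))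
      (f := fun m x => (s x)⁻¹ * (psdDens G x * a m x) i j)
      (fun m => (hsm.inv.mul (hmeas m)).aestronglyMeasurable) (by norm_num) hB ?_
    · filter_upwards [hlim] with x ⟨l, hl⟩
      refine ⟨s x * l, ?_⟩
      have := hl.const_mul (s x)
      simpa only [mul_inv_cancel_left₀ (hspos x).ne'] using this
    · intro N m l hm hl
      rw [eLpNorm_eq_lintegral_rpow_enorm_toReal (by norm_num) (by norm_num)]
      have hpt : ∀ x, ‖((fun x => (s x)⁻¹ * (psdDens G x * a m x) i j) -
          fun x => (s x)⁻¹ * (psdDens G x * a l x) i j) x‖ₑ ^ (2 : ℝ≥0∞).toReal ≤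
          ENNReal.ofReal (frob (a m x - a l x) (psdDens G x * (a m x - a l x))) := fun x => by
        have hM := psdDens_posSemidef G x
        have h1 := sq_mul_apply_le hM (a m x - a l x) i j
        have h2 := frob_form_nonneg hM (a m x - a l x)
        have h3 : s x ^ 2 = 1 + psdDens G x i i :=
          Real.sq_sqrt (by linarith [psd_diag_nonneg hM i])
        rw [ENNReal.toReal_ofNat, ENNReal.rpow_ofNat, Pi.sub_apply, ← mul_sub, ← Matrix.sub_apply,
          ← Matrix.mul_sub, ← ofReal_norm, ← ENNReal.ofReal_pow (norm_nonneg _),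
          Real.norm_eq_abs, sq_abs]
        refine ENNReal.ofReal_le_ofReal ?_
        rw [mul_pow, inv_pow, inv_mul_le_iff₀ (pow_pos (hspos x) 2), h3]
        linarith
      refine (ENNReal.rpow_le_rpow (lintegral_mono hpt) (by norm_num)).trans_lt ?_
      refine (ENNReal.rpow_lt_rpow (h N m l hm hl) (by norm_num)).trans_le ?_
      rw [← ENNReal.rpow_natCast _ 2, ← ENNReal.rpow_mul]
      norm_num
  choose f hf hlim using key
  exact ⟨fun x => Matrix.of fun i j => f i j x, hf,
    ae_all_iff.2 fun i => ae_all_iff.2 fun j => hlim i j⟩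

variable {Λ : Weights n k} {G : VectorMeasure X (symMat n)}

lemma PreL2.inner_eq (v w : PreL2 Λ G) :
    ⟪v, w⟫ = ∫ x, wForm Λ (psdDens G x) (v.1 x) (w.1 x) ∂(refMeasure (toMat G)) := rfl

lemma PreL2.ofReal_norm_sq (v : PreL2 Λ G) : ENNReal.ofReal (‖v‖ ^ 2) = sqNorm Λ G v.1 := by
  rw [← real_inner_self_eq_norm_sq, PreL2.inner_eq, ofReal_integral_eq_lintegral_ofReal
    (integrable_wForm v.2 v.2) (Filter.Eventually.of_forall fun x =>
      wForm_nonneg Λ (psdDens_posSemidef G x) _)]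
  rfl

/-- A Riesz–Fischer argument: along a rapidly Cauchy sequence `(uₘ, Wₘ)` the fields `G uₘ Λ₁†` and
`G Wₘ Λ₂⁻¹` converge almost everywhere, and the Moore–Penrose inverse of `G` turns their limits into
a measurable limit field. -/
instance PreL2.completeSpace : CompleteSpace (PreL2 Λ G) := by
  refine Metric.complete_of_convergent_controlled_sequences (fun N => (1 / 2 : ℝ) ^ N)
    (fun N => by positivity) fun u hu => ?_
  have hsq : ∀ N m l, N ≤ m → N ≤ l →
      sqNorm Λ G ((u m).1 - (u l).1) < ((2⁻¹ : ℝ≥0∞) ^ N) ^ 2 := fun N m l hm hl => by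
    have h1 := hu N m l hm hl
    rw [dist_eq_norm] at h1
    have h2 : ENNReal.ofReal (‖u m - u l‖ ^ 2) < ENNReal.ofReal (((1 / 2 : ℝ) ^ N) ^ 2) :=
      (ENNReal.ofReal_lt_ofReal_iff (by positivity)).2
        (pow_lt_pow_left₀ h1 (norm_nonneg _) two_ne_zero)
    rw [PreL2.ofReal_norm_sq, ENNReal.ofReal_pow (by positivity), ENNReal.ofReal_pow (by norm_num),
      one_div, ENNReal.ofReal_inv_of_pos two_pos, ENNReal.ofReal_ofNat] at h2
    exact h2
  have hm1 : ∀ m i j, Measurable fun x => ((u m).1 x).1 i j := fun m => (u m).2.1.1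
  have hm2 : ∀ m i j, Measurable fun x => ((u m).1 x).2 i j := fun m => (u m).2.1.2
  obtain ⟨F₁, hF₁, hlim₁⟩ := exists_limit_psdDens_mul G
    (a := fun m x => ((u m).1 x).1 * pinv Λ.Λ₁) (fun m => measurable_mul_const (hm1 m) _)
    fun N m l hm hl => (lintegral_mono fun x => ENNReal.ofReal_le_ofReal (by
      rw [← Matrix.sub_mul, wForm_eq]
      exact le_add_of_nonneg_right (frob_form_nonneg (psdDens_posSemidef G x) _))).trans_lt
      (hsq N m l hm hl)
  obtain ⟨F₂, hF₂, hlim₂⟩ := exists_limit_psdDens_mul G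
    (a := fun m x => ((u m).1 x).2 * pinv Λ.Λ₂) (fun m => measurable_mul_const (hm2 m) _)
    fun N m l hm hl => (lintegral_mono fun x => ENNReal.ofReal_le_ofReal (by
      rw [← Matrix.sub_mul, wForm_eq]
      exact le_add_of_nonneg_left (frob_form_nonneg (psdDens_posSemidef G x) _))).trans_lt
      (hsq N m l hm hl)
  set v : X → Matrix (Fin n) (Fin k) ℝ × Matrix (Fin n) (Fin n) ℝ := fun x =>
    (pinv (psdDens G x) * F₁ x * Λ.Λ₁, pinv (psdDens G x) * F₂ x * Λ.Λ₂) with hv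
  have hp := measurable_pinv_field (fun x => psd_isSymm (psdDens_posSemidef G x))
    (measurable_psdDens G)
  have hvm : MeasField v := ⟨measurable_mul_const (measurable_mul_field hp hF₁) _,
    measurable_mul_const (measurable_mul_field hp hF₂) _⟩
  have hum : ∀ m, MeasField ((u m).1 - v) := fun m =>
    ⟨fun i j => (hm1 m i j).sub (hvm.1 i j), fun i j => (hm2 m i j).sub (hvm.2 i j)⟩
  have humm : ∀ m l, MeasField ((u m).1 - (u l).1) := fun m l =>
    ⟨fun i j => (hm1 m i j).sub (hm1 l i j), fun i j => (hm2 m i j).sub (hm2 l i j)⟩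
  have hbound : ∀ N, sqNorm Λ G ((u N).1 - v) ≤ ((2⁻¹ : ℝ≥0∞) ^ N) ^ 2 := fun N => by
    have h1 : sqNorm Λ G ((u N).1 - v) = ∫⁻ x, Filter.liminf (fun l =>
        ENNReal.ofReal (wForm Λ (psdDens G x) (((u N).1 - (u l).1) x) (((u N).1 - (u l).1) x)))
        Filter.atTop ∂(refMeasure (toMat G)) := by
      refine lintegral_congr_ae ?_
      filter_upwards [hlim₁, hlim₂] with x h₁ h₂
      have hs := psd_isSymm (psdDens_posSemidef G x)
      refine (Filter.Tendsto.liminf_eq ?_).symm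
      refine (ENNReal.continuous_ofReal.tendsto _).comp ?_
      simp only [wForm_eq]
      exact (tendsto_frob_form hs (psd_isSymm Λ.posSemidef) h₁ _).add
        (tendsto_frob_form hs (psd_isSymm Λ.posDef.posSemidef) h₂ _)
    rw [h1]
    refine (lintegral_liminf_le fun l =>
      (measurable_wForm Λ G (humm N l) (humm N l)).ennreal_ofReal).trans ?_
    refine Filter.liminf_le_of_frequently_le' (Filter.Eventually.frequently ?_)
    filter_upwards [Filter.eventually_ge_atTop N] with l hl
    exact (hsq N N l le_rfl hl).le
  have hmem : ∀ m, (u m).1 - v ∈ fieldSpace Λ G := fun m =>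
    ⟨hum m, (hbound m).trans_lt (by simp)⟩
  have hvmem : v ∈ fieldSpace Λ G := by
    have := (fieldSpace Λ G).sub_mem (u 0).2 (hmem 0)
    rwa [sub_sub_cancel] at this
  let v' : PreL2 Λ G := ⟨v, hvmem⟩
  have hnorm : ∀ N, ‖u N - v'‖ ≤ (1 / 2 : ℝ) ^ N := fun N => by
    have h1 : ENNReal.ofReal (‖u N - v'‖ ^ 2) ≤ ENNReal.ofReal (((1 / 2 : ℝ) ^ N) ^ 2) := by
      rw [PreL2.ofReal_norm_sq, ENNReal.ofReal_pow (by positivity),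
        ENNReal.ofReal_pow (by norm_num), one_div, ENNReal.ofReal_inv_of_pos two_pos,
        ENNReal.ofReal_ofNat]
      exact hbound N
    rw [ENNReal.ofReal_le_ofReal_iff (by positivity)] at h1
    exact le_of_sq_le_sq h1 (by positivity)
  refine ⟨v', tendsto_iff_norm_sub_tendsto_zero.2 (squeeze_zero (fun _ => norm_nonneg _) hnorm
    (tendsto_pow_atTop_nhds_zero_of_lt_one (by norm_num) (by norm_num)))⟩

end Measures

/-! ### Minimum norm solutions in a Hilbert space -/

section Hilbert

variable {E V : Type*} [NormedAddCommGroup E] [InnerProductSpace ℝ E] {T : V → E} {ell : V → ℝ}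
  {v w : E}

lemma inner_eq_zero_of_mem_closure_range (h : ∀ φ, ⟪T φ, w⟫ = 0) {x : E}
    (hx : x ∈ closure (Set.range T)) : ⟪x, w⟫ = 0 := by
  have hc : IsClosed {x : E | ⟪x, w⟫ = 0} :=
    isClosed_eq (continuous_id.inner continuous_const) continuous_const
  refine closure_minimal ?_ hc hx
  rintro _ ⟨φ, rfl⟩
  exact h φ

lemma norm_sq_eq_of_mem_closure_range (hv : v ∈ closure (Set.range T))
    (hvc : ∀ φ, ⟪T φ, v⟫ = ell φ) (hwc : ∀ φ, ⟪T φ, w⟫ = ell φ) :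
    ‖w‖ ^ 2 = ‖v‖ ^ 2 + ‖w - v‖ ^ 2 := by
  have h := inner_eq_zero_of_mem_closure_range (T := T) (w := w - v)
    (fun φ => by rw [inner_sub_right, hvc, hwc, sub_self]) hv
  have h1 := norm_add_sq_real v (w - v)
  rw [h, add_sub_cancel] at h1
  linarith

/-- The dual functional `ell φ - ½ ‖T φ‖²` equals `½ ‖v‖² - ½ ‖v - T φ‖²`, so its supremum is
approached as `T φ` tends to `v`. -/
lemma iSup_sub_half_norm_sq (hv : v ∈ closure (Set.range T))
    (hvc : ∀ φ, ⟪T φ, v⟫ = ell φ) :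
    ⨆ φ : V, ((ell φ - 1 / 2 * ‖T φ‖ ^ 2 : ℝ) : EReal) = ((1 / 2 * ‖v‖ ^ 2 : ℝ) : EReal) := by
  have e : ∀ φ, ell φ - 1 / 2 * ‖T φ‖ ^ 2 = 1 / 2 * ‖v‖ ^ 2 - 1 / 2 * ‖v - T φ‖ ^ 2 := fun φ => by
    rw [norm_sub_sq_real, real_inner_comm, hvc]
    ring
  refine le_antisymm (iSup_le fun φ => EReal.coe_le_coe_iff.2 ?_) ?_
  · rw [e]
    linarith [sq_nonneg ‖v - T φ‖]
  · refine le_of_forall_lt fun c hc => ?_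
    obtain ⟨r, hcr, hr⟩ := EReal.lt_iff_exists_real_btwn.1 hc
    have hr' : r < 1 / 2 * ‖v‖ ^ 2 := EReal.coe_lt_coe_iff.1 hr
    obtain ⟨_, ⟨φ, rfl⟩, hφ⟩ := Metric.mem_closure_iff.1 hv (√(2 * (1 / 2 * ‖v‖ ^ 2 - r)))
      (Real.sqrt_pos.2 (by linarith))
    refine hcr.trans_le (le_trans ?_ (le_iSup _ φ))
    refine EReal.coe_le_coe_iff.2 ?_
    rw [dist_eq_norm] at hφ
    have h2 := pow_lt_pow_left₀ hφ (norm_nonneg _) two_ne_zero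
    rw [Real.sq_sqrt (by linarith)] at h2
    rw [e]
    linarith

end Hilbert

/-! ### The energy of a curve -/

section Problem

variable {d n k : ℕ} {S : ConvexDomain d} {D : FirstOrderOp d n k} {Λ : Weights n k}
  {G₀ G₁ : VectorMeasure S.Ω (symMat n)} {G : VectorMeasure S.Q (symMat n)}
  {q : VectorMeasure S.Q (Matrix (Fin n) (Fin k) ℝ)}
  {R : VectorMeasure S.Q (Matrix (Fin n) (Fin n) ℝ)}

lemma continuous_C1 (Φ : C1 S n) :
    Continuous fun z : S.Q => (Φ.1 z : Matrix (Fin n) (Fin n) ℝ) :=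
  continuous_subtype_val.comp
    (continuousOn_iff_continuous_domRestrict.1 (ContDiffOn.continuousOn Φ.2))

lemma continuous_app (D : FirstOrderOp d n k) (Φ : C1 S n) :
    Continuous fun z : S.Q => D.app S Φ.1 z := by
  have hΦ : Continuous fun z : S.Q => Φ.1 z :=
    continuousOn_iff_continuous_domRestrict.1 (ContDiffOn.continuousOn Φ.2)
  unfold FirstOrderOp.app dx
  exact (D.zeroth.continuous_of_finiteDimensional.comp hΦ).add
    (continuous_finsetSum _ fun j _ =>
      (D.first j).continuous_of_finiteDimensional.comp (continuous_fderivWithin_Q S Φ _))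

lemma exists_bound_entries {a b : ℕ} {f : S.Q → Matrix (Fin a) (Fin b) ℝ} (hf : Continuous f) :
    ∃ K, ∀ i j z, ‖f z i j‖ ≤ K := by
  have : CompactSpace S.Q := isCompact_iff_compactSpace.1 S.isCompact_Q
  have h : ∀ i j, ∃ K, ∀ z, ‖f z i j‖ ≤ K := fun i j => by
    obtain ⟨K, hK⟩ := isCompact_univ.exists_bound_of_continuousOn
      (hf.matrix_elem i j).continuousOn
    exact ⟨K, fun z => hK z (mem_univ z)⟩
  choose K hK using h
  refine ⟨∑ i, ∑ j, |K i j|, fun i j z => (hK i j z).trans ((le_abs_self _).trans ?_)⟩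
  exact (Finset.single_le_sum (f := fun j => |K i j|) (fun _ _ => abs_nonneg _)
    (Finset.mem_univ j)).trans (Finset.single_le_sum (f := fun i => ∑ j, |K i j|)
      (fun _ _ => Finset.sum_nonneg fun _ _ => abs_nonneg _) (Finset.mem_univ i))

/-- The weak continuity equation for `(q, R)` is the constraint of the minimum norm problem for a
representing field. -/
lemma inner_T_eq_pairing {v : fieldSpace Λ G} (hv : Represents Λ G q R v.1) (Φ : C1 S n) :
    ⟪T S D Λ G Φ, L2.mk Λ G v⟫ = pairing q (fun z => D.app S Φ.1 z) +
      pairing R (fun z => (Φ.1 z : Matrix (Fin n) (Fin n) ℝ)) := by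
  obtain ⟨K₁, hK₁⟩ := exists_bound_entries (continuous_app D Φ)
  obtain ⟨K₂, hK₂⟩ := exists_bound_entries (continuous_C1 Φ)
  exact hv.integral_wForm_eq (fun i j => ((continuous_app D Φ).matrix_elem i j).measurable)
    (fun i j => ((continuous_C1 Φ).matrix_elem i j).measurable) (K := max K₁ K₂)
    (fun i j z => (hK₁ i j z).trans (le_max_left _ _))
    (fun i j z => (hK₂ i j z).trans (le_max_right _ _))

lemma mem_constraintSet_iff_isCE {v : fieldSpace Λ G} (hv : Represents Λ G q R v.1) :
    L2.mk Λ G v ∈ constraintSet S D Λ G₀ G₁ G ↔ IsCE S D G₀ G₁ G q R := by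
  refine forall_congr' fun Φ => ?_
  rw [inner_T_eq_pairing hv, lG]
  constructor <;> intro h <;> linarith

lemma L2.mk_surjective : Function.Surjective (L2.mk Λ G) :=
  SeparationQuotient.surjective_mk (X := PreL2 Λ G)

lemma mem_closure_range_of_mem_H {v : L2 Λ G} (hv : v ∈ H S D Λ G) :
    v ∈ closure (Set.range fun Φ => T S D Λ G Φ) := hv

lemma norm_sq_eq_of_mem_constraintSet {v w : L2 Λ G} (hv : v ∈ H S D Λ G)
    (hvc : v ∈ constraintSet S D Λ G₀ G₁ G) (hwc : w ∈ constraintSet S D Λ G₀ G₁ G) :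
    ‖w‖ ^ 2 = ‖v‖ ^ 2 + ‖w - v‖ ^ 2 :=
  norm_sq_eq_of_mem_closure_range (T := fun Φ => T S D Λ G Φ) (ell := fun Φ => lG S G₀ G₁ G Φ)
    (mem_closure_range_of_mem_H hv) hvc hwc

lemma iSup_lG_sub_half_norm_sq {v : L2 Λ G} (hv : v ∈ H S D Λ G)
    (hvc : v ∈ constraintSet S D Λ G₀ G₁ G) :
    ⨆ Φ : C1 S n, ((lG S G₀ G₁ G Φ - 1 / 2 * ‖T S D Λ G Φ‖ ^ 2 : ℝ) : EReal) =
      ((1 / 2 * ‖v‖ ^ 2 : ℝ) : EReal) :=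
  iSup_sub_half_norm_sq (T := fun Φ => T S D Λ G Φ) (ell := fun Φ => lG S G₀ G₁ G Φ)
    (mem_closure_range_of_mem_H hv) hvc

lemma denseRange_TH (S : ConvexDomain d) (D : FirstOrderOp d n k) (Λ : Weights n k)
    (G : VectorMeasure S.Q (symMat n)) : DenseRange (TH S D Λ G) := fun y => by
  refine Metric.mem_closure_iff.2 fun ε hε => ?_
  obtain ⟨_, ⟨Φ, rfl⟩, hΦ⟩ := Metric.mem_closure_iff.1 (mem_closure_range_of_mem_H y.2) ε hε
  exact ⟨TH S D Λ G Φ, ⟨Φ, rfl⟩, hΦ⟩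

lemma ofReal_norm_sq_mk (v : fieldSpace Λ G) :
    ENNReal.ofReal (‖L2.mk Λ G v‖ ^ 2) = sqNorm Λ G v.1 :=
  PreL2.ofReal_norm_sq (show PreL2 Λ G from v)

lemma ofReal_half_norm_sq_mk (v : fieldSpace Λ G) :
    ENNReal.ofReal (1 / 2 * ‖L2.mk Λ G v‖ ^ 2) = 1 / 2 * sqNorm Λ G v.1 := by
  rw [ENNReal.ofReal_mul (by norm_num), ofReal_norm_sq_mk, ENNReal.ofReal_div_of_pos two_pos,
    ENNReal.ofReal_one, ENNReal.ofReal_ofNat]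

lemma represents_pinvField (h : action Λ G q R < ⊤) :
    Represents Λ G q R (pinvField S G q R) :=
  represents_of_action_lt_top h

lemma action_eq_half_sqNorm_pinvField (h : action Λ G q R < ⊤) :
    action Λ G q R = 1 / 2 * sqNorm Λ G (pinvField S G q R) :=
  (represents_pinvField h).action_eq

lemma pinvField_mem (h : action Λ G q R < ⊤) : pinvField S G q R ∈ fieldSpace Λ G := by
  refine ⟨measField_pinv_dens G q R _, ?_⟩
  rw [action_eq_half_sqNorm_pinvField h] at h
  rw [lt_top_iff_ne_top] at h ⊢
  intro h0
  rw [h0] at h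
  exact h (ENNReal.mul_top (by simp))

/-- An element of `H_{G,Λ}(D*)` satisfying the constraint has half squared norm equal to the energy:
it is no longer than any `(G† q, G† R)`, and it represents an admissible pair of measures itself. -/
lemma energy_eq_of_mem_H (hG : G ∈ AC S D Λ G₀ G₁) {v : L2 Λ G} (hv : v ∈ H S D Λ G)
    (hvc : v ∈ constraintSet S D Λ G₀ G₁ G) :
    energy S D Λ G₀ G₁ G = ENNReal.ofReal (1 / 2 * ‖v‖ ^ 2) := by
  refine le_antisymm ?_ (le_iInf fun q => le_iInf fun R => le_iInf fun h => ?_)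
  · obtain ⟨f, rfl⟩ := L2.mk_surjective v
    obtain ⟨q₀, R₀, h₀⟩ := hG
    obtain ⟨q, R, hr⟩ := exists_represents (represents_pinvField h₀.2).psdDens_ae_eq f.2
    have hact : action Λ G q R < ⊤ := by
      rw [hr.action_eq]
      exact ENNReal.mul_lt_top (by simp) f.2.2
    refine iInf_le_of_le q (iInf_le_of_le R (iInf_le_of_le
      ⟨(mem_constraintSet_iff_isCE hr).1 hvc, hact⟩ ?_))
    rw [← action_eq_half_sqNorm_pinvField hact, hr.action_eq, ofReal_half_norm_sq_mk]
  · have hc := (mem_constraintSet_iff_isCE (v := ⟨_, pinvField_mem h.2⟩)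
      (represents_pinvField h.2)).2 h.1
    rw [← ofReal_half_norm_sq_mk ⟨_, pinvField_mem h.2⟩]
    refine ENNReal.ofReal_le_ofReal ?_
    generalize L2.mk Λ G ⟨_, pinvField_mem h.2⟩ = w at hc
    rw [norm_sq_eq_of_mem_constraintSet hv hvc hc]
    linarith [sq_nonneg ‖w - v‖]

lemma WBsq_eq_iInf_energy (S : ConvexDomain d) (D : FirstOrderOp d n k) (Λ : Weights n k)
    (G₀ G₁ : VectorMeasure S.Ω (symMat n)) :
    WBsq S D Λ G₀ G₁ = ⨅ G ∈ AC S D Λ G₀ G₁, energy S D Λ G₀ G₁ G := by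
  refine le_antisymm ?_ ?_
  · refine le_iInf₂ fun G _ => le_iInf fun q => le_iInf fun R => le_iInf fun h => ?_
    rw [← action_eq_half_sqNorm_pinvField h.2]
    exact iInf_le_of_le G (iInf_le_of_le q (iInf_le_of_le R (iInf_le _ h.1)))
  · refine le_iInf fun G => le_iInf fun q => le_iInf fun R => le_iInf fun h => ?_
    by_cases hact : action Λ G q R < ⊤
    · refine iInf₂_le_of_le G ⟨q, R, h, hact⟩ ?_
      refine iInf_le_of_le q (iInf_le_of_le R (iInf_le_of_le ⟨h, hact⟩ ?_))
      rw [← action_eq_half_sqNorm_pinvField hact]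
    · rw [not_lt_top_iff.1 hact]
      exact le_top

/-- The Riesz representative: for `G ∈ AC`, the constraint set meets `H_{G,Λ}(D*)`. -/
lemma exists_mem_H_constraintSet (hG : G ∈ AC S D Λ G₀ G₁) :
    ∃ v : H S D Λ G, (v : L2 Λ G) ∈ constraintSet S D Λ G₀ G₁ G := by
  obtain ⟨q, R, h⟩ := hG
  have hc := (mem_constraintSet_iff_isCE (v := ⟨_, pinvField_mem h.2⟩)
    (represents_pinvField h.2)).2 h.1
  have : CompleteSpace (H S D Λ G) :=
    (Submodule.isClosed_topologicalClosure _).completeSpace_coe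
  refine ⟨(H S D Λ G).orthogonalProjectionOnto (L2.mk Λ G ⟨_, pinvField_mem h.2⟩), fun Φ => ?_⟩
  rw [← hc Φ]
  exact Submodule.inner_orthogonalProjectionOnto_eq_of_mem_left (TH S D Λ G Φ) _

end Problem

end

theorem mainTheorem6 {d n k : ℕ} (S : ConvexDomain d) (D : FirstOrderOp d n k) (Λ : Weights n k)
    (G₀ G₁ : VectorMeasure S.Ω (symMat n)) (hG₀ : IsPSD G₀) (hG₁ : IsPSD G₁) :
    (WBsq S D Λ G₀ G₁ = ⨅ G ∈ AC S D Λ G₀ G₁, energy S D Λ G₀ G₁ G) ∧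
    ∀ G ∈ AC S D Λ G₀ G₁,
      ∃ l : StrongDual ℝ (H S D Λ G),
        (∀ l' : StrongDual ℝ (H S D Λ G),
          (∀ Φ : C1 S n, l' (TH S D Λ G Φ) = lG S G₀ G₁ G Φ) ↔ l' = l) ∧
        energy S D Λ G₀ G₁ G = ENNReal.ofReal (1 / 2 * ‖l‖ ^ 2) ∧
        (∃ v : H S D Λ G,
          (∀ h : H S D Λ G, ⟪v, h⟫ = l h) ∧
          energy S D Λ G₀ G₁ G = ENNReal.ofReal (1 / 2 * ‖v‖ ^ 2) ∧
          ∀ w : L2 Λ G,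
            (w ∈ constraintSet S D Λ G₀ G₁ G ∧
              IsMinOn (fun w' : L2 Λ G => 1 / 2 * ‖w'‖ ^ 2) (constraintSet S D Λ G₀ G₁ G) w) ↔
            w = v) ∧
        ((energy S D Λ G₀ G₁ G : ℝ≥0∞) : EReal) =
          ⨆ Φ : C1 S n, ((lG S G₀ G₁ G Φ - 1 / 2 * ‖T S D Λ G Φ‖ ^ 2 : ℝ) : EReal) := by
  refine ⟨WBsq_eq_iInf_energy S D Λ G₀ G₁, fun G hG => ?_⟩
  obtain ⟨v, hvc⟩ := exists_mem_H_constraintSet hG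
  have he := energy_eq_of_mem_H hG v.2 hvc
  have hl : ∀ Φ, innerSL ℝ v (TH S D Λ G Φ) = lG S G₀ G₁ G Φ := fun Φ => by
    rw [innerSL_apply_apply, real_inner_comm]
    exact hvc Φ
  refine ⟨innerSL ℝ v, fun l' => ⟨fun h => ?_, fun h => by rw [h]; exact hl⟩, ?_,
    ⟨v, fun h => rfl, he, fun w => ⟨fun hw => ?_, ?_⟩⟩, ?_⟩
  · refine ContinuousLinearMap.coeFn_injective ?_
    exact (denseRange_TH S D Λ G).equalizer l'.continuous (innerSL ℝ v).continuous
      (funext fun Φ => (h Φ).trans (hl Φ).symm)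
  · rw [innerSL_apply_norm]
    exact he
  · have h1 := norm_sq_eq_of_mem_constraintSet v.2 hvc hw.1
    have h2 : 1 / 2 * ‖w‖ ^ 2 ≤ 1 / 2 * ‖(v : L2 Λ G)‖ ^ 2 := hw.2 hvc
    have h3 : ‖w - v‖ ^ 2 = 0 := le_antisymm (by linarith) (sq_nonneg _)
    exact sub_eq_zero.1 (norm_eq_zero.1 (pow_eq_zero_iff two_ne_zero |>.1 h3))
  · rintro rfl
    refine ⟨hvc, fun w hw => ?_⟩
    have h1 := norm_sq_eq_of_mem_constraintSet v.2 hvc hw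
    change 1 / 2 * ‖(v : L2 Λ G)‖ ^ 2 ≤ 1 / 2 * ‖w‖ ^ 2
    linarith [sq_nonneg ‖w - v‖]
  · rw [iSup_lG_sub_half_norm_sq v.2 hvc, he, EReal.coe_ennreal_ofReal, max_eq_left (by positivity)]
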